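/- **Problem.** Let $\alpha,\beta\in(1,2)$, $T>0$, $\Omega=(x_L,x_R)\times(y_L,y_R)$ with $x_L<x_R$, $y_L<y_R$, and let $d,e$ be nonnegative bounded functions on $\Omega$. For a function $v$ put $J_a^{\alpha}v(z)=\frac1{\Gamma(2-\alpha)}\int_a^z\frac{v(\xi)}{(z-\xi)^{\alpha-1}}d\xi$ for $-\infty\le a<z$, let ${}_aD^{\alpha}v=(J_a^{\alpha}v)''$ be the left Riemann–Liouville derivative of order $\alpha$, and ${}_{-\infty}D^{\alpha+2}v=(J_{-\infty}^{\alpha}v)''''$. Let $u$ be a classical solution of $$u_t=d(x,y)\,{}_{x_L}D_x^{\alpha}u+e(x,y)\,{}_{y_L}D_y^{\beta}u+f(x,y,t)\ \text{ in }\Omega\times(0,T],\qquad u=0\text{ on }\partial\Omega\times[0,T],\qquad u(\cdot,\cdot,0)=\varphi\text{ on }\bar\Omega .$$ **Smoothness.** Assume that $u$ is smooth enough in the following sense, for some constant $K$. (a) For all $y\in(y_L,y_R)$ and $t\in[0,T]$, the function $u(\cdot,y,t)$ on $[x_L,x_R]$ has a continuous extension $V\in L^1(\mathbb R)$ vanishing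 on $(-\infty,x_L]$ such that $J_{-\infty}^{\alpha}V\in C^4(\mathbb R)$, and ${}_{-\infty}D^{\alpha+2}V$ and its Fourier transform belong to $L^1(\mathbb R)$, the $L^1$ norm of the latter (with kernel $e^{-2\pi i x\omega}$) being at most $K$. The same holds in the variable $y$, with $\beta$ in place of $\alpha$, for all $x\in(x_L,x_R)$ and $t\in[0,T]$. (b) For all $(x,y)\in\Omega$, the function $u(x,y,\cdot)$ is $C^3$ on $[0,T]$, the functions ${}_{x_L}D_x^{\alpha}u(x,y,\cdot)$ and ${}_{y_L}D_y^{\beta}u(x,y,\cdot)$ are $C^2$ on $[0,T]$, and the third, respectively second, time derivatives are bounded by $K$ in absolute value. **Scheme.** For positive integers $M_1,M_2,N$ let $h_1=\frac{x_R-x_L}{M_1+1}$, $h_2=\frac{y_R-y_L}{M_2+1}$, $\tau=T/N$, $x_i=x_L+ih_1$, $y_j=y_L+jh_2$, $t_n=n\tau$, $t_{n-\frac12}=\frac{t_{n-1}+t_n}{2}$. Let $g_0^{(\alpha)}=1$, $g_k^{(\alpha)}=\bigl(1-\frac{\alpha+1}{k}\bigr)g_{k-1}^{(\alpha)}$, $w_0^{(\alpha)}=\frac{\alpha}{2}g_0^{(\alpha)}$,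 $w_k^{(\alpha)}=\frac{\alpha}{2}g_k^{(\alpha)}+\frac{2-\alpha}{2}g_{k-1}^{(\alpha)}$ for $k\ge1$. Let $G_\alpha\in\mathbb R^{M_1\times M_1}$ have the entry $w_{i-k+1}^{(\alpha)}$ in position $(i,k)$ if $k\le i+1$ and $0$ otherwise, and define $G_\beta\in\mathbb R^{M_2\times M_2}$ in the same way. Order the interior grid points $(x_i,y_j)$, $1\le i\le M_1$, $1\le j\le M_2$, with $i$ running fastest. Let $D,E$ be the diagonal matrices of the values of $d,e$ at these points, let $f^{n-\frac12}$ be the vector of the values $f(x_i,y_j,t_{n-\frac12})$, and put $$A=\frac1{2h_1^{\alpha}}D(I\otimes G_\alpha)+\frac1{2h_2^{\beta}}E(G_\beta\otimes I).$$ The Crank–Nicolson/WSGD scheme is $$\frac1\tau(u^n-u^{n-1})=A(u^{n-1}+u^n)+f^{n-\frac12},\quad 1\le n\le N,\qquad u^0=(\varphi(x_i,y_j))_{i,j}.$$ **The set $\mathfrak D$.** It consists of the families $Q=(Q_{M_1,M_2,N})$ of real symmetric positive definite $M_1M_2\times M_1M_2$ matrices such that, for all $M_1,M_2,N$, the matrix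 $-\mathcal H(QA)$ is positive semidefinite, where $\mathcal H(X)=\frac12(X+X^{T})$, and $\|Q\|_2\|Q^{-1}\|_2\le c$ for a constant $c$ independent of $\tau,h_1,h_2$. **Theorem 3.2.** For any $Q\in\mathfrak D$ there is a constant $c_4>0$, independent of $M_1,M_2,N$ and $n$, such that for all positive integers $M_1,M_2,N$ the scheme has exactly one solution $(u^n_{i,j})$, and the errors $e^n_{i,j}=u(x_i,y_j,t_n)-u^n_{i,j}$ satisfy $$\|e^n\|\le c_4(\tau^2+h_1^2+h_2^2),\qquad 0\le n\le N,$$ where $\|v\|=\bigl(h_1h_2\sum_{i=1}^{M_1}\sum_{j=1}^{M_2}v_{i,j}^2\bigr)^{1/2}$. -/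

import Mathlib

open scoped FourierTransform Kronecker Matrix

noncomputable section

namespace OSFDE

/-! ### Fractional derivatives -/

/-- `z ↦ (1 / Γ(2-α)) ∫_a^z v(ξ) / (z-ξ)^(α-1) dξ`, the fractional integral of order `2-α`
of `v` with lower limit `a`. -/
def fracInt (a α : ℝ) (v : ℝ → ℝ) (z : ℝ) : ℝ :=
  1 / Real.Gamma (2 - α) * ∫ ξ in a..z, v ξ / (z - ξ) ^ (α - 1)

/-- The left Riemann-Liouville derivative of order `α ∈ (1,2)` of `v` at `x`, lower limit `a`. -/
def rlDeriv (a α : ℝ) (v : ℝ → ℝ) (x : ℝ) : ℝ :=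
  iteratedDeriv 2 (fracInt a α v) x

/-- The Riemann-Liouville derivative exists at `x`: the integrand is integrable for upper limits
near `x`, and the fractional integral is twice differentiable at `x`. -/
def HasRLDerivAt (a α : ℝ) (v : ℝ → ℝ) (x : ℝ) : Prop :=
  (∀ᶠ z in nhds x,
    IntervalIntegrable (fun ξ => v ξ / (z - ξ) ^ (α - 1)) MeasureTheory.volume a z ∧
    DifferentiableAt ℝ (fracInt a α v) z) ∧
  DifferentiableAt ℝ (deriv (fracInt a α v)) x

/-- The fractional integral of order `2-α` with lower limit `-∞`. -/
def fracIntLine (α : ℝ) (V : ℝ → ℝ) (z : ℝ) : ℝ :=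
  1 / Real.Gamma (2 - α) * ∫ ξ in Set.Iio z, V ξ / (z - ξ) ^ (α - 1)

/-- For `α ∈ (1,2)`, the derivative of order `α + 2 ∈ (3,4)` with lower limit `-∞`: the fourth
derivative of the fractional integral of order `4 - (α + 2) = 2 - α`. -/
def lineDerivAddTwo (α : ℝ) (V : ℝ → ℝ) (x : ℝ) : ℝ :=
  iteratedDeriv 4 (fracIntLine α V) x

/-- Spatial smoothness of `v : [a,b] → ℝ`. It has a continuous extension `V` to the line, zero on
`(-∞, a]`, such that `V`, its derivative of order `α + 2` with lower limit `-∞`, and the Fourier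
transform of that derivative belong to `L¹(ℝ)`; the last `L¹`-norm is at most `K`. -/
def SpaceSmooth (a b α K : ℝ) (v : ℝ → ℝ) : Prop :=
  ∃ V : ℝ → ℝ, Continuous V ∧ (∀ x ≤ a, V x = 0) ∧ (∀ x ∈ Set.Icc a b, V x = v x) ∧
    MeasureTheory.Integrable V ∧
    ContDiff ℝ 4 (fracIntLine α V) ∧
    MeasureTheory.Integrable (lineDerivAddTwo α V) ∧
    MeasureTheory.Integrable (𝓕 (fun x : ℝ => (lineDerivAddTwo α V x : ℂ))) ∧
    ∫ ω : ℝ, ‖𝓕 (fun x : ℝ => (lineDerivAddTwo α V x : ℂ)) ω‖ ≤ K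

/-! ### The two-dimensional equation -/

/-- The data of the problem `u_t = d D_x^α u + e D_y^β u + f` on `(xL,xR) × (yL,yR) × (0,T]`
with zero boundary values and initial value `φ`. -/
structure Problem where
  (α β xL xR yL yR T : ℝ)
  (d e : ℝ → ℝ → ℝ)
  (f : ℝ → ℝ → ℝ → ℝ)
  (φ : ℝ → ℝ → ℝ)

namespace Problem

variable (P : Problem)

/-- The open rectangle `Ω`. -/
def Ω : Set (ℝ × ℝ) := Set.Ioo P.xL P.xR ×ˢ Set.Ioo P.yL P.yR

/-- Standing assumptions on the data. -/
structure Admissible : Prop where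
  hα : P.α ∈ Set.Ioo (1 : ℝ) 2
  hβ : P.β ∈ Set.Ioo (1 : ℝ) 2
  hx : P.xL < P.xR
  hy : P.yL < P.yR
  hT : 0 < P.T
  d_nonneg : ∀ x y, (x, y) ∈ P.Ω → 0 ≤ P.d x y
  e_nonneg : ∀ x y, (x, y) ∈ P.Ω → 0 ≤ P.e x y
  d_bdd : ∃ B, ∀ x y, (x, y) ∈ P.Ω → P.d x y ≤ B
  e_bdd : ∃ B, ∀ x y, (x, y) ∈ P.Ω → P.e x y ≤ B

/-- `u x y t` is an exact (classical) solution of the initial-boundary value problem. -/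
structure IsSolution (u : ℝ → ℝ → ℝ → ℝ) : Prop where
  rl_x : ∀ x y, (x, y) ∈ P.Ω → ∀ t ∈ Set.Ioc 0 P.T,
    HasRLDerivAt P.xL P.α (fun ξ => u ξ y t) x
  rl_y : ∀ x y, (x, y) ∈ P.Ω → ∀ t ∈ Set.Ioc 0 P.T,
    HasRLDerivAt P.yL P.β (fun η => u x η t) y
  pde : ∀ x y, (x, y) ∈ P.Ω → ∀ t ∈ Set.Ioc 0 P.T,
    HasDerivWithinAt (fun s => u x y s)
      (P.d x y * rlDeriv P.xL P.α (fun ξ => u ξ y t) x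
        + P.e x y * rlDeriv P.yL P.β (fun η => u x η t) y + P.f x y t)
      (Set.Icc 0 P.T) t
  boundary : ∀ x y, (x, y) ∈ frontier P.Ω → ∀ t ∈ Set.Icc 0 P.T, u x y t = 0
  initial : ∀ x y, (x, y) ∈ closure P.Ω → u x y 0 = P.φ x y

/-- `u` is smooth enough: uniformly over the other variables it is smooth in `x` and in `y` in the
sense of `SpaceSmooth`, it is three times continuously differentiable in time, its fractional
derivatives are twice continuously differentiable in time, and these time derivatives are
bounded. -/
def SmoothEnough (u : ℝ → ℝ → ℝ → ℝ) : Prop :=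
  ∃ K : ℝ,
    (∀ y ∈ Set.Ioo P.yL P.yR, ∀ t ∈ Set.Icc 0 P.T,
      SpaceSmooth P.xL P.xR P.α K (fun x => u x y t)) ∧
    (∀ x ∈ Set.Ioo P.xL P.xR, ∀ t ∈ Set.Icc 0 P.T,
      SpaceSmooth P.yL P.yR P.β K (fun y => u x y t)) ∧
    ∀ x y, (x, y) ∈ P.Ω →
      (ContDiffOn ℝ 3 (fun t => u x y t) (Set.Icc 0 P.T) ∧
        ∀ t ∈ Set.Icc 0 P.T,
          |iteratedDerivWithin 3 (fun s => u x y s) (Set.Icc 0 P.T) t| ≤ K) ∧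
      (ContDiffOn ℝ 2 (fun t => rlDeriv P.xL P.α (fun ξ => u ξ y t) x) (Set.Icc 0 P.T) ∧
        ∀ t ∈ Set.Icc 0 P.T,
          |iteratedDerivWithin 2 (fun s => rlDeriv P.xL P.α (fun ξ => u ξ y s) x)
            (Set.Icc 0 P.T) t| ≤ K) ∧
      (ContDiffOn ℝ 2 (fun t => rlDeriv P.yL P.β (fun η => u x η t) y) (Set.Icc 0 P.T) ∧
        ∀ t ∈ Set.Icc 0 P.T,
          |iteratedDerivWithin 2 (fun s => rlDeriv P.yL P.β (fun η => u x η s) y)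
            (Set.Icc 0 P.T) t| ≤ K)

end Problem

/-! ### The Crank-Nicolson / WSGD scheme -/

/-- The coefficients `g_k` of the power series of `(1-z)^α`. -/
def g (α : ℝ) : ℕ → ℝ
  | 0 => 1
  | k + 1 => (1 - (α + 1) / ((k : ℝ) + 1)) * g α k

/-- The weights `w_k` of the weighted and shifted Grünwald-Letnikov difference. -/
def w (α : ℝ) : ℕ → ℝ
  | 0 => α / 2 * g α 0
  | k + 1 => α / 2 * g α (k + 1) + (2 - α) / 2 * g α k

/-- The Toeplitz matrix `G_α` of size `M`: `w_{i-k+1}` in row `i` and column `k` if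
`k ≤ i + 1`, and zero otherwise. -/
def G (α : ℝ) (M : ℕ) : Matrix (Fin M) (Fin M) ℝ :=
  Matrix.of fun i k => if (k : ℕ) ≤ (i : ℕ) + 1 then w α ((i : ℕ) + 1 - (k : ℕ)) else 0

/-- A mesh, given by the positive integers `M₁`, `M₂`, `N`. -/
structure Mesh where
  (M₁ M₂ N : ℕ)
  M₁_pos : 0 < M₁
  M₂_pos : 0 < M₂
  N_pos : 0 < N

/-- Indices of interior grid points. `(j, i)` stands for the point `(x_{i+1}, y_{j+1})`, so that in
the lexicographic order the `x`-index runs fastest. -/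
abbrev Mesh.Idx (m : Mesh) : Type := Fin m.M₂ × Fin m.M₁

/-- Spectral condition number `‖X‖₂ ‖X⁻¹‖₂` (used for invertible `X`). -/
def cond {ι : Type*} [Fintype ι] [DecidableEq ι] (X : Matrix ι ι ℝ) : ℝ :=
  ‖Matrix.toEuclideanCLM (n := ι) (𝕜 := ℝ) X‖ * ‖Matrix.toEuclideanCLM (n := ι) (𝕜 := ℝ) X⁻¹‖

/-- Symmetric part of a square matrix. -/
def symPart {ι : Type*} (X : Matrix ι ι ℝ) : Matrix ι ι ℝ := (1 / 2 : ℝ) • (X + Xᵀ)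

namespace Problem

variable (P : Problem) (m : Mesh)

/-- Time step. -/
def τ : ℝ := P.T / m.N
/-- Step in `x`. -/
def h₁ : ℝ := (P.xR - P.xL) / (m.M₁ + 1)
/-- Step in `y`. -/
def h₂ : ℝ := (P.yR - P.yL) / (m.M₂ + 1)
/-- Grid point `x_i`. -/
def gx (i : ℕ) : ℝ := P.xL + i * P.h₁ m
/-- Grid point `y_j`. -/
def gy (j : ℕ) : ℝ := P.yL + j * P.h₂ m
/-- Time level `t_n`. -/
def gt (n : ℕ) : ℝ := n * P.τ m

/-- The values of a function at the interior grid points. -/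
def sample (v : ℝ → ℝ → ℝ) : m.Idx → ℝ :=
  fun p => v (P.gx m ((p.2 : ℕ) + 1)) (P.gy m ((p.1 : ℕ) + 1))

/-- The matrix `A = D (I ⊗ G_α) / (2 h₁^α) + E (G_β ⊗ I) / (2 h₂^β)`. -/
def A : Matrix m.Idx m.Idx ℝ :=
  (1 / (2 * P.h₁ m ^ P.α)) • (Matrix.diagonal (P.sample m P.d) *
      ((1 : Matrix (Fin m.M₂) (Fin m.M₂) ℝ) ⊗ₖ G P.α m.M₁)) +
  (1 / (2 * P.h₂ m ^ P.β)) • (Matrix.diagonal (P.sample m P.e) *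
      (G P.β m.M₂ ⊗ₖ (1 : Matrix (Fin m.M₁) (Fin m.M₁) ℝ)))

/-- `U n` (`n = 0, …, N`) solves the scheme: `U 0` is the sampled initial value and
`(U n - U (n-1)) / τ = A (U (n-1) + U n) + f^{n-1/2}` for `1 ≤ n ≤ N`. -/
def IsSchemeSolution (U : Fin (m.N + 1) → m.Idx → ℝ) : Prop :=
  U 0 = P.sample m P.φ ∧
  ∀ n : Fin m.N,
    (1 / P.τ m) • (U n.succ - U n.castSucc) =
      P.A m *ᵥ (U n.castSucc + U n.succ) +
        P.sample m (fun x y => P.f x y ((P.gt m (n : ℕ) + P.gt m ((n : ℕ) + 1)) / 2))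

/-- The discrete `L²` norm of a grid function. -/
def gridNorm (v : m.Idx → ℝ) : ℝ := Real.sqrt (P.h₁ m * P.h₂ m * (v ⬝ᵥ v))

/-- The error `e^n` at the interior grid points (at boundary grid points both the exact and the
discrete solution vanish). -/
def err (u : ℝ → ℝ → ℝ → ℝ) (U : Fin (m.N + 1) → m.Idx → ℝ) (n : Fin (m.N + 1)) : m.Idx → ℝ :=
  fun p => P.sample m (fun x y => u x y (P.gt m (n : ℕ))) p - U n p

/-- The set `𝔇`. An element is a family of matrices, one for each mesh, which are positive definite,
make `-H(XA)` positive semidefinite, and have condition numbers bounded independently of the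
mesh. -/
def 𝔇 : Set ((m : Mesh) → Matrix m.Idx m.Idx ℝ) :=
  {X | (∀ m, (X m).PosDef ∧ (-symPart (X m * P.A m)).PosSemidef) ∧ ∃ c : ℝ, ∀ m, cond (X m) ≤ c}

end Problem

end OSFDE

end

noncomputable section

namespace OSFDE

/-! The error satisfies the Crank–Nicolson recursion with zero initial value and the local
truncation error as source, so the theorem is stability plus second order consistency.

Stability (`norm_le_of_crankNicolson`): write `Q = Bᵀ B` and pair the recursion with `Q (e₀ + e₁)`.
Semidefiniteness makes the contribution of `A` nonpositive, so `‖B e‖` grows by at most `τ ‖B R‖`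
per step. Returning to the Euclidean norm costs the square root of the condition number, which is
bounded over all meshes. The same sign condition makes `1 - τ A` injective, which gives existence
and uniqueness.

Consistency in time is a Taylor argument about the midpoint of each step. Consistency in space is
proved on the Fourier side. With `z = 2πiω`, the difference of step `s` is multiplication by `s^(-α)
∑ w_k e^((1-k)zs)` and the fractional derivative is multiplication by `z^α`. The generating function
`(1 - ζ)^α` of `g` gives the first symbol in closed form; the weights `α/2` and `(2-α)/2` cancel its
first order error, and off a neighbourhood of `0` crude bounds suffice
(`exists_norm_symbol_sub_le`). The discrepancy is thus at most `C s² |z|^(α+2)`. As `|z|^(α+2) |𝓕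
V|` is the modulus of the transform of the derivative of order `α + 2`, an `L¹` function with norm
at most `K`, Fourier inversion yields an `O(s²)` error uniform in the point
(`exists_abs_difference_sub_le`).

That the derivative of order `α + 2` has symbol `z^(α+2)` is not immediate, because the fractional
integral need not be integrable. Since `V` vanishes on a left half line, Laplace transforms with `Re
s > 0` can be used instead, followed by `Re s → 0` (`fourier_lineDerivAddTwo`). -/

/-! ### Grünwald coefficients and their generating function -/

/-- Coefficient form of `d/dz (1-z)^α = -α (1-z)^(α-1)`. -/
theorem g_succ_eq_mul_g_sub_one (α : ℝ) (n : ℕ) :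
    g α (n + 1) = -α / ((n : ℝ) + 1) * g (α - 1) n := by
  induction n with
  | zero => simp [g]
  | succ n ih =>
    rw [g, ih, g]
    have h1 : (n : ℝ) + 1 ≠ 0 := by positivity
    have h2 : (n : ℝ) + 1 + 1 ≠ 0 := by positivity
    push_cast
    field_simp
    ring

/-- Taking partial sums of coefficients is division of `(1-z)^α` by `1-z`. -/
theorem sum_range_g (α : ℝ) (n : ℕ) :
    ∑ k ∈ Finset.range (n + 1), g α k = g (α - 1) n := by
  induction n with
  | zero => simp [g]
  | succ n ih =>
    rw [Finset.sum_range_succ, ih, g_succ_eq_mul_g_sub_one, g]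
    ring

theorem g_add_two_nonneg {α : ℝ} (hα : α ∈ Set.Ioo (1 : ℝ) 2) (k : ℕ) : 0 ≤ g α (k + 2) := by
  obtain ⟨h1, h2⟩ := hα
  induction k with
  | zero =>
    simp only [g]
    norm_num
    nlinarith
  | succ k ih =>
    rw [g]
    refine mul_nonneg ?_ ih
    rw [sub_nonneg, div_le_one (by positivity)]
    push_cast
    linarith [(k.cast_nonneg : (0 : ℝ) ≤ k)]

theorem g_succ_nonpos {α : ℝ} (hα : α ∈ Set.Ioo (0 : ℝ) 1) (k : ℕ) : g α (k + 1) ≤ 0 := by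
  obtain ⟨h1, h2⟩ := hα
  induction k with
  | zero => simp [g]; linarith
  | succ k ih =>
    rw [g]
    refine mul_nonpos_of_nonneg_of_nonpos ?_ ih
    rw [sub_nonneg, div_le_one (by positivity)]
    push_cast
    linarith [(k.cast_nonneg : (0 : ℝ) ≤ k)]

/-- From index `2` on the coefficients are nonnegative, so bounded partial sums suffice. A full
partial sum is a coefficient of `(1-z)^(α-1)`, hence nonpositive, and the first two terms add up to
`1 - α`. -/
theorem summable_abs_g {α : ℝ} (hα : α ∈ Set.Ioo (1 : ℝ) 2) : Summable fun k => |g α k| := by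
  rw [← summable_nat_add_iff 2]
  have h0 : ∀ k, |g α (k + 2)| = g α (k + 2) := fun k => abs_of_nonneg (g_add_two_nonneg hα k)
  simp_rw [h0]
  refine summable_of_sum_range_le (c := α) (fun k => g_add_two_nonneg hα k) fun n => ?_
  have h1 := sum_range_g α (n + 1)
  rw [Finset.sum_range_succ', Finset.sum_range_succ'] at h1
  have h2 := g_succ_nonpos (α := α - 1) ⟨by linarith [hα.1], by linarith [hα.2]⟩ n
  simp only [g] at h1 h2 ⊢
  norm_num at h1 h2 ⊢
  linarith

theorem summable_abs_w {α : ℝ} (hα : α ∈ Set.Ioo (1 : ℝ) 2) : Summable fun k => |w α k| := by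
  rw [← summable_nat_add_iff 1]
  have hg := summable_abs_g hα
  have hg1 := (summable_nat_add_iff 1).2 hg
  refine Summable.of_nonneg_of_le (fun _ => abs_nonneg _) (fun k => ?_)
    ((hg1.mul_left |α / 2|).add (hg.mul_left |(2 - α) / 2|))
  rw [w, ← abs_mul, ← abs_mul]
  exact abs_add_le _ _

theorem g_eq_choose (α : ℝ) (k : ℕ) : g α k = (-1) ^ k * Ring.choose α k := by
  induction k with
  | zero => simp [g]
  | succ k ih =>
    have h := Ring.descPochhammer_eq_factorial_smul_choose α k
    have h' := Ring.descPochhammer_eq_factorial_smul_choose α (k + 1)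
    rw [descPochhammer_succ_right, Polynomial.smeval_mul, h] at h'
    simp [Polynomial.smeval_natCast, Nat.factorial_succ] at h'
    have hk : (k.factorial : ℝ) ≠ 0 := by positivity
    have hk1 : (k : ℝ) + 1 ≠ 0 := by positivity
    have h3 : Ring.choose α k * (α - k) = (k + 1) * Ring.choose α (k + 1) := by
      apply mul_left_cancel₀ hk
      linarith
    rw [g, ih]
    have h4 : Ring.choose α (k + 1) = Ring.choose α k * (α - k) / (k + 1) := by
      field_simp
      linarith
    rw [h4]
    field_simp
    ring

theorem hasSum_g_mul_pow (α : ℝ) {z : ℂ} (hz : ‖z‖ < 1) :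
    HasSum (fun k => (g α k : ℂ) * z ^ k) ((1 - z) ^ (α : ℂ)) := by
  have h := (Complex.one_add_cpow_hasFPowerSeriesOnBall_zero (a := (α : ℂ))).hasSum
    (y := -z) (by simpa [Metric.mem_eball, edist_zero_right, enorm_eq_nnnorm] using! hz)
  simp only [binomialSeries_apply, List.ofFn_const, List.prod_replicate,
    ← sub_eq_add_neg, smul_eq_mul, zero_sub] at h
  have hk : (fun k => (g α k : ℂ) * z ^ k) = fun k => Ring.choose (α : ℂ) k * (-z) ^ k := by
    ext k
    rw [g_eq_choose, neg_pow z]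
    push_cast
    ring
  rw [hk]
  exact h

/-- Radial limit of the binomial series: absolute summability makes the series continuous up to the
circle, and `z ≠ 1` keeps `1 - z` in the slit plane, where the power is continuous. -/
theorem tsum_g_mul_pow_of_norm_eq_one {α : ℝ} (hα : α ∈ Set.Ioo (1 : ℝ) 2) {z : ℂ} (hz : ‖z‖ = 1)
    (hz1 : z ≠ 1) : ∑' k, (g α k : ℂ) * z ^ k = (1 - z) ^ (α : ℂ) := by
  have hslit : 1 - z ∈ Complex.slitPlane := by
    left
    have h1 : z.re ≤ 1 := hz ▸ Complex.re_le_norm z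
    have h2 : z.re ≠ 1 := by
      intro h
      apply hz1
      have := Complex.sq_norm z
      rw [hz, Complex.normSq_apply, h] at this
      have hi : z.im = 0 := by nlinarith
      exact Complex.ext h hi
    have := lt_of_le_of_ne h1 h2
    simp; linarith
  have hcont : ContinuousOn (fun r : ℝ => ∑' k, (g α k : ℂ) * ((r : ℂ) * z) ^ k) (Set.Icc 0 1) := by
    refine continuousOn_tsum (fun k => by fun_prop) (summable_abs_g hα) fun k r hr => ?_
    rw [norm_mul, norm_pow, norm_mul, hz, mul_one, Complex.norm_real, Complex.norm_real,
      Real.norm_eq_abs, Real.norm_eq_abs]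
    exact mul_le_of_le_one_right (abs_nonneg _)
      (pow_le_one₀ (abs_nonneg _) (by rw [abs_of_nonneg hr.1]; exact hr.2))
  have hl : Filter.Tendsto (fun r : ℝ => ∑' k, (g α k : ℂ) * ((r : ℂ) * z) ^ k)
      (nhdsWithin 1 (Set.Ico 0 1)) (nhds (∑' k, (g α k : ℂ) * z ^ k)) := by
    have := (hcont 1 ⟨zero_le_one, le_rfl⟩).mono (Set.Ico_subset_Icc_self)
    simpa [ContinuousWithinAt] using this
  have hr : Filter.Tendsto (fun r : ℝ => (1 - (r : ℂ) * z) ^ (α : ℂ))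
      (nhdsWithin 1 (Set.Ico 0 1)) (nhds ((1 - z) ^ (α : ℂ))) := by
    have : ContinuousAt (fun r : ℝ => (1 - (r : ℂ) * z) ^ (α : ℂ)) 1 := by
      refine ContinuousAt.cpow (by fun_prop) continuousAt_const ?_
      simpa using hslit
    have := this.tendsto.mono_left (nhdsWithin_le_nhds (s := Set.Ico 0 1))
    simpa using this
  have : (nhdsWithin (1 : ℝ) (Set.Ico 0 1)).NeBot := by
    rw [← mem_closure_iff_nhdsWithin_neBot, closure_Ico zero_ne_one]
    simp
  refine tendsto_nhds_unique hl (hr.congr' ?_)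
  filter_upwards [self_mem_nhdsWithin] with r hr
  refine ((hasSum_g_mul_pow α ?_).tsum_eq).symm
  rw [norm_mul, hz, mul_one, Complex.norm_real, Real.norm_eq_abs, abs_of_nonneg hr.1]
  exact hr.2

/-! ### The symbol of the weighted difference on the imaginary axis -/

theorem summable_w_mul {α : ℝ} (hα : α ∈ Set.Ioo (1 : ℝ) 2) {c : ℕ → ℂ} (hc : ∀ k, ‖c k‖ = 1) :
    Summable fun k => (w α k : ℂ) * c k := by
  refine Summable.of_norm ?_
  simpa [hc] using summable_abs_w hα

/-- The weights combine two Grünwald differences with shifts `1` and `0`; these contribute the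
factors `e^z` and `1` to a common `(1 - e^(-z))^α`. -/
theorem tsum_w_mul_exp {α : ℝ} (hα : α ∈ Set.Ioo (1 : ℝ) 2) {z : ℂ} (hz : z.re = 0)
    (hz1 : Complex.exp (-z) ≠ 1) :
    ∑' k : ℕ, (w α k : ℂ) * Complex.exp ((1 - k) * z) =
      (α / 2 * Complex.exp z + (2 - α) / 2) * (1 - Complex.exp (-z)) ^ (α : ℂ) := by
  have hn : ‖Complex.exp (-z)‖ = 1 := by rw [Complex.norm_exp]; simp [hz]
  have hg : Summable fun k => (g α k : ℂ) * Complex.exp (-z) ^ k := by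
    refine Summable.of_norm ?_
    simpa [hn] using summable_abs_g hα
  have hgs := tsum_g_mul_pow_of_norm_eq_one hα hn hz1
  have hw : Summable fun k : ℕ => (w α k : ℂ) * Complex.exp ((1 - k) * z) :=
    summable_w_mul hα fun k => by rw [Complex.norm_exp]; simp [hz]
  rw [hw.tsum_eq_zero_add]
  have h1 := hg.tsum_eq_zero_add
  have hterm : ∀ k : ℕ, (w α (k + 1) : ℂ) * Complex.exp ((1 - (k + 1 : ℕ)) * z) =
      α / 2 * Complex.exp z * ((g α (k + 1) : ℂ) * Complex.exp (-z) ^ (k + 1)) +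
        (2 - α) / 2 * ((g α k : ℂ) * Complex.exp (-z) ^ k) := by
    intro k
    rw [w, ← Complex.exp_nat_mul, ← Complex.exp_nat_mul]
    have e1 : Complex.exp ((1 - (k + 1 : ℕ)) * z) =
        Complex.exp z * Complex.exp ((k + 1 : ℕ) * -z) := by
      rw [← Complex.exp_add]; congr 1; push_cast; ring
    have e2 : Complex.exp ((1 - (k + 1 : ℕ)) * z) = Complex.exp (k * -z) := by
      congr 1; push_cast; ring
    push_cast at e1 e2 ⊢
    rw [add_mul]
    nth_rewrite 1 [e1]
    rw [e2]
    ring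
  simp_rw [hterm]
  rw [Summable.tsum_add (((summable_nat_add_iff 1).2 hg).mul_left _) (hg.mul_left _),
    tsum_mul_left, tsum_mul_left]
  rw [hgs] at h1 ⊢
  have h2 : ∑' k : ℕ, (g α (k + 1) : ℂ) * Complex.exp (-z) ^ (k + 1) =
      (1 - Complex.exp (-z)) ^ (α : ℂ) - g α 0 := by
    rw [h1]; simp
  rw [h2]
  simp [w]
  ring

theorem one_add_cpow_sub_isBigO (α : ℂ) :
    (fun p : ℂ => (1 + p) ^ α - 1 - α * p) =O[nhds 0] fun p => p ^ 2 := by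
  have h := (Complex.one_add_cpow_hasFPowerSeriesAt_zero (a := α)).isBigO_sub_partialSum_pow 2
  rw [← Asymptotics.isBigO_norm_right]
  refine (h.congr_left fun y => ?_).congr_right fun y => by simp
  simp only [FormalMultilinearSeries.partialSum, Finset.sum_range_succ, binomialSeries_apply]
  simp [sub_sub, mul_comm]

theorem exp_sub_one_sub_isBigO :
    (fun z : ℂ => Complex.exp z - 1 - z) =O[nhds 0] fun z => z ^ 2 := by
  refine Asymptotics.IsBigO.of_bound 1 ?_
  filter_upwards [Metric.ball_mem_nhds (0 : ℂ) one_pos] with z hz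
  rw [one_mul, norm_pow]
  exact Complex.norm_exp_sub_one_sub_id_le (by simpa using (mem_ball_zero_iff.1 hz).le)

theorem one_sub_exp_neg_div_isBigO :
    (fun z : ℂ => (1 - Complex.exp (-z)) / z - 1 + z / 2) =O[nhdsWithin 0 {0}ᶜ] fun z => z ^ 2 := by
  refine Asymptotics.IsBigO.of_bound 1 ?_
  filter_upwards [self_mem_nhdsWithin,
    mem_nhdsWithin_of_mem_nhds (Metric.ball_mem_nhds (0 : ℂ) one_pos)] with z hz0 hz
  have hz0 : z ≠ 0 := hz0
  have h := Complex.exp_bound (x := -z) (by simpa using (mem_ball_zero_iff.1 hz).le)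
    (n := 3) (by norm_num)
  simp only [Finset.sum_range_succ, Finset.range_zero, Finset.sum_empty, Nat.factorial,
    norm_neg] at h
  have e : (1 - Complex.exp (-z)) / z - 1 + z / 2 = -(Complex.exp (-z) - (1 - z + z ^ 2 / 2)) / z := by
    field_simp
    ring
  rw [e, norm_div, norm_neg, div_le_iff₀ (norm_pos_iff.2 hz0), norm_pow, one_mul, ← pow_succ]
  norm_num at h
  have h2 : ‖Complex.exp (-z) - (1 - z + z ^ 2 / 2)‖ ≤ ‖z‖ ^ 3 * (2 / 9) := by
    convert h using 3
    ring
  exact h2.trans (by nlinarith [pow_nonneg (norm_nonneg z) 3])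

/-- Consistency of second order of the symbol of the weighted and shifted difference. -/
theorem symbol_sub_one_isBigO (α : ℝ) :
    (fun z : ℂ => (α / 2 * Complex.exp z + (2 - α) / 2) *
      ((1 - Complex.exp (-z)) / z) ^ (α : ℂ) - 1) =O[nhdsWithin 0 {0}ᶜ] fun z => z ^ 2 := by
  set l : Filter ℂ := nhdsWithin 0 {0}ᶜ
  have hid : Filter.Tendsto (fun z : ℂ => z) l (nhds 0) := nhdsWithin_le_nhds
  have hpsq := one_sub_exp_neg_div_isBigO
  set φ : ℂ → ℂ := fun z => (1 - Complex.exp (-z)) / z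
  have hz2z : (fun z : ℂ => z ^ 2) =O[l] fun z => z := by
    have h : (fun z : ℂ => z) =O[l] fun _ => (1 : ℂ) := hid.isBigO_one ℂ
    simpa [pow_two] using h.mul (Asymptotics.isBigO_refl (fun z : ℂ => z) l)
  have hp : (fun z => φ z - 1) =O[l] fun z => z := by
    have h1 : (fun z : ℂ => z / 2) =O[l] fun z => z := by
      simpa [div_eq_inv_mul] using (Asymptotics.isBigO_refl (fun z : ℂ => z) l).const_mul_left 2⁻¹
    refine ((hpsq.trans hz2z).sub h1).congr_left fun z => ?_
    simp [φ]
  have hp0 : Filter.Tendsto (fun z => φ z - 1) l (nhds 0) := hp.trans_tendsto hid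
  have hb : (fun z => φ z ^ (α : ℂ) - 1 + α * z / 2) =O[l] fun z => z ^ 2 := by
    have h1 := ((one_add_cpow_sub_isBigO α).comp_tendsto hp0).trans (hp.pow 2)
    refine (h1.add (hpsq.const_mul_left (α : ℂ))).congr_left fun z => ?_
    simp [φ]
    ring
  have ha : (fun z : ℂ => α / 2 * Complex.exp z + (2 - α) / 2 - 1 - α * z / 2) =O[l]
      fun z => z ^ 2 := by
    refine ((exp_sub_one_sub_isBigO.comp_tendsto hid).const_mul_left (α / 2 : ℂ)).congr_left
      fun z => ?_
    simp
    ring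
  have hb1 : (fun z => φ z ^ (α : ℂ)) =O[l] fun _ => (1 : ℂ) := by
    have h1 : Filter.Tendsto (fun z => φ z ^ (α : ℂ)) l (nhds ((1 : ℂ) ^ (α : ℂ))) := by
      have : Filter.Tendsto φ l (nhds 1) := by
        simpa using hp0.add_const 1
      exact this.cpow tendsto_const_nhds (by simp)
    exact h1.isBigO_one ℂ
  have hc1 : (fun z : ℂ => 1 + α * z / 2) =O[l] fun _ => (1 : ℂ) := by
    have h1 : Filter.Tendsto (fun z : ℂ => 1 + α * z / 2) l (nhds (1 + α * 0 / 2)) := by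
      exact ((hid.const_mul _).div_const _).const_add _
    exact h1.isBigO_one ℂ
  -- The factors are `a = 1 + αz/2 + O(z²)` and `b = 1 - αz/2 + O(z²)`, and `ab - 1 = (a - 1 - αz/2)
  -- b + (b - 1 + αz/2)(1 + αz/2) - α²z²/4`: the linear terms cancel.
  have hsum := ((ha.mul hb1).add (hb.mul hc1 |>.congr_right fun z => rfl)).sub
    (((Asymptotics.isBigO_refl (fun z : ℂ => z ^ 2) l).const_mul_left (α ^ 2 / 4 : ℂ)).congr_right
      fun z => (mul_one _).symm)
  refine (hsum.congr_left fun z => ?_).congr_right fun z => mul_one _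
  simp only [φ]
  ring

/-- The arguments are at most `π/2` and less than `π/2` in modulus, so their sum stays in the
principal range and the logarithms add. -/
theorem cpow_mul_of_re_eq_zero {z v : ℂ} (hz : z ≠ 0) (hz0 : z.re = 0) (hv : 0 < v.re) (r : ℂ) :
    (z * v) ^ r = z ^ r * v ^ r := by
  have hv0 : v ≠ 0 := by rintro rfl; simp at hv
  have h1 : |z.arg| ≤ Real.pi / 2 := Complex.abs_arg_le_pi_div_two_iff.2 hz0.ge
  have h2 : |v.arg| < Real.pi / 2 := Complex.abs_arg_lt_pi_div_two_iff.2 (Or.inl hv)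
  rw [abs_le] at h1
  rw [abs_lt] at h2
  rw [Complex.cpow_def_of_ne_zero (mul_ne_zero hz hv0), (Complex.log_mul_eq_add_log_iff hz hv0).2 ⟨by linarith, by linarith⟩,
    Complex.cpow_def_of_ne_zero hz, Complex.cpow_def_of_ne_zero hv0, ← Complex.exp_add]
  ring_nf

/-- The symbol of the weighted and shifted Grünwald difference approximates that of the
fractional derivative to second order, globally on the imaginary axis. -/
theorem exists_norm_symbol_sub_le {α : ℝ} (hα : α ∈ Set.Ioo (1 : ℝ) 2) :
    ∃ C, 0 ≤ C ∧ ∀ z : ℂ, z.re = 0 → z ≠ 0 →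
      ‖∑' k : ℕ, (w α k : ℂ) * Complex.exp ((1 - k) * z) - z ^ (α : ℂ)‖ ≤ C * ‖z‖ ^ (α + 2) := by
  obtain ⟨C₁, hC₁, h1⟩ := (symbol_sub_one_isBigO α).exists_pos
  -- The quotient tends to `1`. Positivity of its real part allows `z^α` to be split off and also
  -- excludes `e^(-z) = 1`.
  have h2 : ∀ᶠ z in nhdsWithin (0 : ℂ) {0}ᶜ, 0 < ((1 - Complex.exp (-z)) / z).re := by
    have hp : Filter.Tendsto (fun z : ℂ => (1 - Complex.exp (-z)) / z - 1 + z / 2)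
        (nhdsWithin 0 {0}ᶜ) (nhds 0) := by
      refine one_sub_exp_neg_div_isBigO.trans_tendsto ?_
      have : Filter.Tendsto (fun z : ℂ => z ^ 2) (nhds 0) (nhds (0 ^ 2)) :=
        (continuous_pow 2).tendsto 0
      simpa using this.mono_left nhdsWithin_le_nhds
    have hq : Filter.Tendsto (fun z : ℂ => 1 - z / 2) (nhdsWithin 0 {0}ᶜ) (nhds (1 - 0 / 2)) :=
      ((continuous_const.sub (continuous_id.div_const 2)).tendsto (0 : ℂ)).mono_left
        nhdsWithin_le_nhds
    have := (Complex.continuous_re.tendsto _).comp (hp.add hq)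
    have h3 := this.eventually (lt_mem_nhds (show (0 : ℝ) < (0 + (1 - 0 / 2) : ℂ).re by simp))
    filter_upwards [h3] with z hz
    simpa using hz
  have h3 := h1.bound.and h2
  rw [eventually_nhdsWithin_iff, Metric.eventually_nhds_iff] at h3
  obtain ⟨δ, hδ, h3⟩ := h3
  set S := ∑' k, |w α k|
  have hS : 0 ≤ S := tsum_nonneg fun k => abs_nonneg _
  have hα2 : 0 < α + 2 := by linarith [hα.1]
  -- `C₁` serves `‖z‖ < δ`. Beyond that the trivial bound `S + ‖z‖^α` is raised to order `α + 2` by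
  -- powers of `‖z‖/δ ≥ 1`.
  refine ⟨C₁ + (S * (1 / δ) ^ (α + 2) + (1 / δ) ^ 2), by positivity, fun z hz hz0 => ?_⟩
  have hzp : 0 < ‖z‖ := norm_pos_iff.2 hz0
  have hcn : ‖z ^ (α : ℂ)‖ ≤ ‖z‖ ^ α := by
    refine (Complex.norm_cpow_le _ _).trans ?_
    simp
  have hcn2 : ‖z‖ ^ (α + 2) = ‖z‖ ^ α * ‖z‖ ^ 2 := by
    rw [Real.rpow_add hzp]
    norm_num
  rw [add_mul]
  rcases lt_or_ge ‖z‖ δ with hlt | hge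
  · obtain ⟨hb, hre⟩ := h3 (by simpa using hlt) (by simpa using hz0)
    have he : Complex.exp (-z) ≠ 1 := by
      intro h
      rw [h] at hre
      simp at hre
    rw [tsum_w_mul_exp hα hz he]
    have e1 : 1 - Complex.exp (-z) = z * ((1 - Complex.exp (-z)) / z) := by field_simp
    rw [e1, cpow_mul_of_re_eq_zero hz0 hz hre]
    have e2 : (α / 2 * Complex.exp z + (2 - α) / 2) *
        (z ^ (α : ℂ) * ((1 - Complex.exp (-z)) / z) ^ (α : ℂ)) - z ^ (α : ℂ) =
        z ^ (α : ℂ) * ((α / 2 * Complex.exp z + (2 - α) / 2) *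
          ((1 - Complex.exp (-z)) / z) ^ (α : ℂ) - 1) := by ring
    rw [e2, norm_mul]
    rw [norm_pow] at hb
    calc _ ≤ ‖z‖ ^ α * (C₁ * ‖z‖ ^ 2) := by gcongr
      _ = C₁ * ‖z‖ ^ (α + 2) := by rw [hcn2]; ring
      _ ≤ _ := le_add_of_nonneg_right (by positivity)
  · have hk : ∀ k : ℕ, ‖(w α k : ℂ) * Complex.exp ((1 - k) * z)‖ = |w α k| := by
      intro k
      rw [norm_mul, Complex.norm_exp]
      simp [hz]
    have hts : ‖∑' k : ℕ, (w α k : ℂ) * Complex.exp ((1 - k) * z)‖ ≤ S := by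
      refine (norm_tsum_le_tsum_norm ?_).trans_eq ?_
      · simpa only [hk] using summable_abs_w hα
      · simp only [hk, S]
    have hq : 1 ≤ 1 / δ * ‖z‖ := by
      rw [one_div_mul_eq_div, one_le_div hδ]; exact hge
    calc _ ≤ S + ‖z‖ ^ α := (norm_sub_le _ _).trans (add_le_add hts hcn)
      _ ≤ S * (1 / δ * ‖z‖) ^ (α + 2) + ‖z‖ ^ α * (1 / δ * ‖z‖) ^ 2 := by
        gcongr
        · exact le_mul_of_one_le_right hS (Real.one_le_rpow hq hα2.le)
        · exact le_mul_of_one_le_right (by positivity) (one_le_pow₀ hq)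
      _ = (S * (1 / δ) ^ (α + 2) + (1 / δ) ^ 2) * ‖z‖ ^ (α + 2) := by
        rw [Real.mul_rpow (by positivity) hzp.le, mul_pow, hcn2]
        ring
      _ ≤ _ := le_add_of_nonneg_left (by positivity)

/-! ### Laplace transforms and the Fourier symbol of the derivative of order `α + 2` -/

/-- The kernel `x_+^(r-1) / Γ(r)` of the Riemann-Liouville integral of order `r`. -/
def rlKernel (r : ℝ) : ℝ → ℝ :=
  Set.indicator (Set.Ioi 0) fun x => x ^ (r - 1) / Real.Gamma r

/-- The two-sided Laplace transform. -/
def laplace (f : ℝ → ℝ) (s : ℂ) : ℂ := ∫ x : ℝ, Complex.exp (-(s * x)) * f x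

theorem measurable_rlKernel (r : ℝ) : Measurable (rlKernel r) :=
  (by fun_prop : Measurable fun x : ℝ => x ^ (r - 1) / Real.Gamma r).indicator measurableSet_Ioi

theorem rlKernel_nonneg {r : ℝ} (hr : 0 < r) (x : ℝ) : 0 ≤ rlKernel r x :=
  Set.indicator_nonneg (fun _ hx => div_nonneg (Real.rpow_nonneg (le_of_lt hx) _)
    (Real.Gamma_pos_of_pos hr).le) x

theorem exp_mul_rlKernel (r b x : ℝ) : Real.exp (-(b * x)) * rlKernel r x =
    Set.indicator (Set.Ioi 0)
      (fun x => (x ^ (r - 1) * Real.exp (-(b * x))) / Real.Gamma r) x := by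
  simp only [rlKernel, Set.indicator_apply]
  split_ifs <;> ring

theorem integrable_exp_mul_rlKernel {r b : ℝ} (hr : 0 < r) (hb : 0 < b) :
    MeasureTheory.Integrable fun x => Real.exp (-(b * x)) * rlKernel r x := by
  simp_rw [exp_mul_rlKernel]
  rw [MeasureTheory.integrable_indicator_iff measurableSet_Ioi]
  have := integrableOn_rpow_mul_exp_neg_mul_rpow (p := 1) (s := r - 1) (by linarith) one_pos hb
  simp only [Real.rpow_one, neg_mul] at this
  exact this.div_const _

theorem integral_exp_mul_rlKernel {r b : ℝ} (hr : 0 < r) (hb : 0 < b) :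
    ∫ x, Real.exp (-(b * x)) * rlKernel r x = b ^ (-r) := by
  simp_rw [exp_mul_rlKernel]
  rw [MeasureTheory.integral_indicator measurableSet_Ioi, MeasureTheory.integral_div,
    Real.integral_rpow_mul_exp_neg_mul_Ioi hr hb,
    mul_div_cancel_right₀ _ (Real.Gamma_pos_of_pos hr).ne', one_div, Real.inv_rpow hb.le,
    Real.rpow_neg hb.le]

theorem norm_cexp_neg_mul_ofReal (s : ℂ) (x : ℝ) :
    ‖Complex.exp (-(s * x))‖ = Real.exp (-(s.re * x)) := by
  rw [Complex.norm_exp]; simp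

theorem integrable_cexp_mul_iff {f : ℝ → ℝ} (hf : Measurable f) (s : ℂ) :
    MeasureTheory.Integrable (fun x : ℝ => Complex.exp (-(s * x)) * (f x : ℂ)) ↔
      MeasureTheory.Integrable fun x => Real.exp (-(s.re * x)) * f x := by
  rw [← MeasureTheory.integrable_norm_iff (by fun_prop), ← MeasureTheory.integrable_norm_iff
    (f := fun x => Real.exp (-(s.re * x)) * f x) (by fun_prop)]
  simp only [norm_mul, norm_cexp_neg_mul_ofReal, Complex.norm_real, Real.norm_eq_abs,
    Real.abs_exp]

-- On the positive reals this is the Gamma integral. Both sides are analytic in the right half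
-- plane, the left one as the complex moment generating function of the measure with density
-- `rlKernel r`, so the identity theorem applies.
open ProbabilityTheory in
theorem laplace_rlKernel {r : ℝ} (hr : 0 < r) {s : ℂ} (hs : 0 < s.re) :
    laplace (rlKernel r) s = s ^ (-r : ℂ) := by
  set μ : MeasureTheory.Measure ℝ :=
    MeasureTheory.volume.withDensity fun x => ENNReal.ofReal (rlKernel r x)
  have hm : Measurable fun x => ENNReal.ofReal (rlKernel r x) :=
    (measurable_rlKernel r).ennreal_ofReal
  have hlt : ∀ᵐ x : ℝ, ENNReal.ofReal (rlKernel r x) < ⊤ := by simp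
  have hL : ∀ z : ℂ, complexMGF id μ (-z) = laplace (rlKernel r) z := by
    intro z
    rw [complexMGF, laplace, integral_withDensity_eq_integral_toReal_smul hm hlt]
    congr 1
    ext x
    rw [ENNReal.toReal_ofReal (rlKernel_nonneg hr x), Complex.real_smul, mul_comm]
    simp
  have hint : Set.Iio 0 ⊆ interior (integrableExpSet id μ) := by
    refine interior_maximal (fun t ht => ?_) isOpen_Iio
    have ht : t < 0 := ht
    rw [integrableExpSet, Set.mem_ofPred_eq,
      MeasureTheory.integrable_withDensity_iff_integrable_smul' hm hlt]
    refine (integrable_exp_mul_rlKernel hr (b := -t) (by linarith)).congr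
      (Filter.Eventually.of_forall fun x => ?_)
    simp only [id, smul_eq_mul]
    rw [ENNReal.toReal_ofReal (rlKernel_nonneg hr x), mul_comm]
    simp
  set U : Set ℂ := {z | 0 < z.re}
  have hU : IsPreconnected U := (convex_halfSpace_re_gt 0).isPreconnected
  have hUo : IsOpen U := isOpen_lt continuous_const Complex.continuous_re
  have h1 : AnalyticOnNhd ℂ (laplace (rlKernel r)) U := by
    refine DifferentiableOn.analyticOnNhd (fun z hz => ?_) hUo
    have h2 : AnalyticAt ℂ (complexMGF id μ) (-z) :=
      analyticAt_complexMGF (hint (by simpa [U] using hz))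
    have h3 : DifferentiableAt ℂ (fun z => complexMGF id μ (-z)) z :=
      h2.differentiableAt.comp z differentiableAt_id.neg
    simp_rw [hL] at h3
    exact h3.differentiableWithinAt
  have h2 : AnalyticOnNhd ℂ (fun z : ℂ => z ^ (-r : ℂ)) U := by
    refine DifferentiableOn.analyticOnNhd (fun z hz => ?_) hUo
    exact (differentiableAt_id.cpow_const (Or.inl hz)).differentiableWithinAt
  refine h1.eqOn_of_preconnected_of_frequently_eq h2 hU (z₀ := 1) (by simp [U]) ?_ hs
  have h_real : ∃ᶠ x : ℝ in nhdsWithin 1 {1}ᶜ, laplace (rlKernel r) x = (x : ℂ) ^ (-r : ℂ) := by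
    refine Filter.Eventually.frequently ?_
    filter_upwards [mem_nhdsWithin_of_mem_nhds (lt_mem_nhds (zero_lt_one' ℝ))] with x hx
    have := integral_exp_mul_rlKernel hr hx
    rw [← Complex.ofReal_neg, ← Complex.ofReal_cpow hx.le, ← this, ← integral_complex_ofReal,
      laplace]
    simp
  refine Filter.Tendsto.frequently ?_ h_real
  refine tendsto_nhdsWithin_iff.2 ⟨?_, ?_⟩
  · exact (Complex.continuous_ofReal.tendsto' 1 1 (by simp)).mono_left nhdsWithin_le_nhds
  · filter_upwards [self_mem_nhdsWithin] with x hx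
    simpa using hx

-- `H` is the convolution of `f` with the kernel, and `x ↦ e^(-sx)` is multiplicative, so the weight
-- distributes over the two factors.
open scoped Convolution in
theorem integrable_and_laplace_of_eq_integral_rlKernel {r : ℝ} (hr : 0 < r) {s : ℂ} (hs : 0 < s.re)
    {f H : ℝ → ℝ} (hf : MeasureTheory.Integrable fun x : ℝ => Complex.exp (-(s * x)) * (f x : ℂ))
    (hH : ∀ x, H x = ∫ ξ, f ξ * rlKernel r (x - ξ)) :
    (MeasureTheory.Integrable fun x : ℝ => Complex.exp (-(s * x)) * (H x : ℂ)) ∧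
      laplace H s = laplace f s * s ^ (-r : ℂ) := by
  have hk : MeasureTheory.Integrable fun x : ℝ => Complex.exp (-(s * x)) * (rlKernel r x : ℂ) :=
    (integrable_cexp_mul_iff (measurable_rlKernel r) s).2 (integrable_exp_mul_rlKernel hr hs)
  have hconv : (fun x : ℝ => Complex.exp (-(s * x)) * (H x : ℂ)) =
      (fun x : ℝ => Complex.exp (-(s * x)) * (f x : ℂ))
        ⋆[ContinuousLinearMap.mul ℝ ℂ, MeasureTheory.volume]
        fun x : ℝ => Complex.exp (-(s * x)) * (rlKernel r x : ℂ) := by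
    ext x
    rw [MeasureTheory.convolution_def, hH, ← integral_complex_ofReal,
      ← MeasureTheory.integral_const_mul]
    congr 1
    ext t
    have : Complex.exp (-(s * x)) = Complex.exp (-(s * t)) * Complex.exp (-(s * (x - t : ℝ))) := by
      rw [← Complex.exp_add]
      congr 1
      push_cast
      ring
    rw [this, ContinuousLinearMap.mul_apply']
    push_cast
    ring
  constructor
  · rw [hconv]
    exact hf.integrable_convolution _ hk
  · rw [laplace, hconv, MeasureTheory.integral_convolution _ hf hk, ContinuousLinearMap.mul_apply',
      ← laplace_rlKernel hr hs, laplace, laplace]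

theorem fracIntLine_eq_integral_rlKernel (α : ℝ) (V : ℝ → ℝ) (z : ℝ) :
    fracIntLine α V z = ∫ ξ, V ξ * rlKernel (2 - α) (z - ξ) := by
  rw [fracIntLine, ← MeasureTheory.integral_const_mul,
    ← MeasureTheory.integral_indicator measurableSet_Iio]
  congr 1
  ext ξ
  by_cases h : ξ < z
  · rw [Set.indicator_of_mem (Set.mem_Iio.2 h), rlKernel,
      Set.indicator_of_mem (Set.mem_Ioi.2 (sub_pos.2 h)),
      show 2 - α - 1 = -(α - 1) by ring, Real.rpow_neg (sub_pos.2 h).le]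
    ring
  · rw [Set.indicator_of_notMem (by simpa using h), rlKernel,
      Set.indicator_of_notMem (by simpa using h), mul_zero]

/-- The kernel of order `1` is the Heaviside function. In this form differentiation is covered by
the same Laplace rule as fractional integration. -/
theorem eq_integral_rlKernel_one_of_hasDerivAt {a : ℝ} {f f' : ℝ → ℝ} (hf : ∀ x, HasDerivAt f (f' x) x)
    (hf' : Continuous f') (h0 : ∀ x ≤ a, f x = 0) (h0' : ∀ x ≤ a, f' x = 0) (x : ℝ) :
    f x = ∫ ξ, f' ξ * rlKernel 1 (x - ξ) := by
  have h1 : ∀ ξ, f' ξ * rlKernel 1 (x - ξ) = Set.indicator (Set.Ioo a x) f' ξ := by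
    intro ξ
    rcases le_or_gt ξ a with h | h
    · rw [h0' ξ h, Set.indicator_of_notMem (by simp [h]), zero_mul]
    · rcases lt_or_ge ξ x with h2 | h2
      · rw [Set.indicator_of_mem (show ξ ∈ Set.Ioo a x from ⟨h, h2⟩), rlKernel,
          Set.indicator_of_mem (Set.mem_Ioi.2 (sub_pos.2 h2))]
        simp
      · rw [Set.indicator_of_notMem (by simp [h2]), rlKernel,
          Set.indicator_of_notMem (by simpa using h2), mul_zero]
  simp_rw [h1]
  rw [MeasureTheory.integral_indicator measurableSet_Ioo, ← MeasureTheory.integral_Ioc_eq_integral_Ioo]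
  rcases le_or_gt x a with h | h
  · rw [h0 x h, Set.Ioc_eq_empty (by simpa using h)]
    simp
  · rw [← intervalIntegral.integral_of_le h.le,
      intervalIntegral.integral_eq_sub_of_hasDerivAt (fun y _ => hf y) (hf'.intervalIntegrable _ _),
      h0 a le_rfl, sub_zero]

theorem fracIntLine_eq_zero {α a : ℝ} {V : ℝ → ℝ} (hV : ∀ x ≤ a, V x = 0) {x : ℝ} (hx : x ≤ a) :
    fracIntLine α V x = 0 := by
  rw [fracIntLine, MeasureTheory.setIntegral_eq_zero_of_forall_eq_zero, mul_zero]
  intro ξ hξ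
  rw [hV ξ (le_of_lt (lt_of_lt_of_le hξ hx)), zero_div]

theorem iteratedDeriv_eq_zero_of_le {a : ℝ} {n : ℕ} {F : ℝ → ℝ} (hF : ContDiff ℝ n F)
    (h0 : ∀ x ≤ a, F x = 0) {x : ℝ} (hx : x ≤ a) : iteratedDeriv n F x = 0 := by
  have hcont : Continuous (iteratedDeriv n F) := hF.continuous_iteratedDeriv n le_rfl
  have h1 : Set.EqOn (iteratedDeriv n F) (fun _ => 0) (Set.Iio a) := by
    intro y hy
    have : F =ᶠ[nhds y] fun _ => (0 : ℝ) := by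
      filter_upwards [Iio_mem_nhds hy] with z hz using h0 z (le_of_lt hz)
    rw [this.iteratedDeriv_eq]
    rcases n with _ | n <;> simp
  have h2 := h1.closure hcont continuous_const
  rw [closure_Iio] at h2
  exact h2 hx

theorem hasDerivAt_iteratedDeriv {n : ℕ} {F : ℝ → ℝ} (hF : ContDiff ℝ (n + 1 : ℕ) F) (x : ℝ) :
    HasDerivAt (iteratedDeriv n F) (iteratedDeriv (n + 1) F x) x := by
  rw [iteratedDeriv_succ]
  exact (hF.differentiable_iteratedDeriv n (by exact_mod_cast n.lt_succ_self) x).hasDerivAt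

/-- Integration by parts `n` times for the Laplace transform. -/
theorem integrable_and_laplace_iteratedDeriv {a : ℝ} {s : ℂ} (hs : 0 < s.re) {F : ℝ → ℝ}
    (h0 : ∀ x ≤ a, F x = 0) (n : ℕ) (hF : ContDiff ℝ n F)
    (hint : MeasureTheory.Integrable fun x : ℝ =>
      Complex.exp (-(s * x)) * ((iteratedDeriv n F x : ℝ) : ℂ)) :
    (MeasureTheory.Integrable fun x : ℝ => Complex.exp (-(s * x)) * (F x : ℂ)) ∧
      laplace (iteratedDeriv n F) s = laplace F s * s ^ n := by
  have hs0 : s ≠ 0 := by rintro rfl; simp at hs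
  induction n with
  | zero => simpa using hint
  | succ n ih =>
    have hFn : ContDiff ℝ n F := hF.of_le (by exact_mod_cast n.le_succ)
    -- Convolution with the kernel of order `1` passes weighted integrability from the higher
    -- derivative down to the lower one.
    have h := integrable_and_laplace_of_eq_integral_rlKernel one_pos hs hint
      (eq_integral_rlKernel_one_of_hasDerivAt (a := a) (hasDerivAt_iteratedDeriv hF)
        (hF.continuous_iteratedDeriv (n + 1) le_rfl)
        (fun x hx => iteratedDeriv_eq_zero_of_le hFn h0 hx)
        (fun x hx => iteratedDeriv_eq_zero_of_le hF h0 hx))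
    obtain ⟨h1, h2⟩ := ih hFn h.1
    refine ⟨h1, ?_⟩
    have h3 := h.2
    rw [h2, Complex.ofReal_one, Complex.cpow_neg_one] at h3
    rw [pow_succ, ← mul_assoc, h3, mul_assoc, inv_mul_cancel₀ hs0, mul_one]

theorem norm_cexp_mul_le {a : ℝ} {f : ℝ → ℝ} (h0 : ∀ x ≤ a, f x = 0) {s : ℂ} (hs : 0 ≤ s.re)
    (x : ℝ) : ‖Complex.exp (-(s * x)) * (f x : ℂ)‖ ≤ Real.exp (s.re * |a|) * |f x| := by
  rw [norm_mul, norm_cexp_neg_mul_ofReal, Complex.norm_real, Real.norm_eq_abs]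
  rcases le_or_gt x a with h | h
  · simp [h0 x h]
  · gcongr
    rw [← mul_neg]
    gcongr
    linarith [neg_abs_le a]

theorem integrable_cexp_mul {a : ℝ} {f : ℝ → ℝ} (h0 : ∀ x ≤ a, f x = 0)
    (hf : MeasureTheory.Integrable f) {s : ℂ} (hs : 0 ≤ s.re) :
    MeasureTheory.Integrable fun x : ℝ => Complex.exp (-(s * x)) * (f x : ℂ) := by
  refine MeasureTheory.Integrable.mono' (hf.abs.const_mul (Real.exp (s.re * |a|))) ?_
    (Filter.Eventually.of_forall fun x => norm_cexp_mul_le h0 hs x)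
  exact (by fun_prop : Continuous fun x : ℝ => Complex.exp (-(s * x))).aestronglyMeasurable.mul
    hf.ofReal.aestronglyMeasurable

theorem fourier_eq_laplace (f : ℝ → ℝ) (ω : ℝ) :
    𝓕 (fun x : ℝ => (f x : ℂ)) ω = laplace f (2 * Real.pi * ω * Complex.I) := by
  rw [Real.fourier_real_eq_integral_exp_smul, laplace]
  congr 1
  ext x
  rw [smul_eq_mul]
  congr 2
  push_cast
  ring

/-- Dominated convergence: as `f` vanishes left of `a`, the weights for `0 < ε < 1` are bounded by
`e^|a|` where they matter. -/
theorem tendsto_laplace {a : ℝ} {f : ℝ → ℝ} (h0 : ∀ x ≤ a, f x = 0)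
    (hf : MeasureTheory.Integrable f) (ω : ℝ) :
    Filter.Tendsto (fun ε : ℝ => laplace f (ε + 2 * Real.pi * ω * Complex.I))
      (nhdsWithin 0 (Set.Ioi 0)) (nhds (𝓕 (fun x : ℝ => (f x : ℂ)) ω)) := by
  rw [fourier_eq_laplace]
  refine MeasureTheory.tendsto_integral_filter_of_dominated_convergence
    (fun x => Real.exp |a| * |f x|) ?_ ?_ (hf.abs.const_mul _) ?_
  · filter_upwards [self_mem_nhdsWithin] with ε hε
    exact (integrable_cexp_mul h0 hf (by simpa using le_of_lt hε)).aestronglyMeasurable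
  · filter_upwards [self_mem_nhdsWithin,
      mem_nhdsWithin_of_mem_nhds (gt_mem_nhds (zero_lt_one' ℝ))] with ε hε hε1
    refine Filter.Eventually.of_forall fun x => ?_
    have hε : 0 < ε := hε
    refine (norm_cexp_mul_le h0 (by simpa using hε.le) x).trans ?_
    gcongr
    simpa using mul_le_mul_of_nonneg_right hε1.le (abs_nonneg a)
  · refine Filter.Eventually.of_forall fun x => ?_
    have : Continuous fun ε : ℝ =>
        Complex.exp (-((ε + 2 * Real.pi * ω * Complex.I) * x)) * (f x : ℂ) := by fun_prop
    exact (this.tendsto' 0 _ (by simp)).mono_left nhdsWithin_le_nhds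

/-- On the Fourier side the derivative of order `α + 2` with lower limit `-∞` is multiplication by
`(2πiω)^(α+2)`. -/
theorem fourier_lineDerivAddTwo {α a : ℝ} (hα : α ∈ Set.Ioo (1 : ℝ) 2) {V : ℝ → ℝ}
    (h0 : ∀ x ≤ a, V x = 0) (hV : MeasureTheory.Integrable V)
    (hF : ContDiff ℝ 4 (fracIntLine α V))
    (hg : MeasureTheory.Integrable (lineDerivAddTwo α V)) {ω : ℝ} (hω : ω ≠ 0) :
    𝓕 (fun x : ℝ => (lineDerivAddTwo α V x : ℂ)) ω =
      𝓕 (fun x : ℝ => (V x : ℂ)) ω * (2 * Real.pi * ω * Complex.I) ^ ((α : ℂ) + 2) := by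
  have hF0 : ∀ x ≤ a, fracIntLine α V x = 0 := fun x hx => fracIntLine_eq_zero h0 hx
  have hg0 : ∀ x ≤ a, lineDerivAddTwo α V x = 0 := fun x hx =>
    iteratedDeriv_eq_zero_of_le (n := 4) (by exact_mod_cast hF) hF0 hx
  have hz : (2 * Real.pi * ω * Complex.I : ℂ) ∈ Complex.slitPlane := by
    right
    simp [hω, Real.pi_ne_zero]
  have hpow : Filter.Tendsto (fun ε : ℝ => (ε + 2 * Real.pi * ω * Complex.I : ℂ) ^ ((α : ℂ) + 2))
      (nhdsWithin 0 (Set.Ioi 0)) (nhds ((2 * Real.pi * ω * Complex.I) ^ ((α : ℂ) + 2))) := by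
    have : ContinuousAt (fun ε : ℝ => (ε + 2 * Real.pi * ω * Complex.I : ℂ) ^ ((α : ℂ) + 2)) 0 :=
      ContinuousAt.cpow (by fun_prop) continuousAt_const (by simpa using hz)
    have := this.tendsto.mono_left (nhdsWithin_le_nhds (s := Set.Ioi 0))
    simpa using this
  refine tendsto_nhds_unique (tendsto_laplace hg0 hg ω)
    (((tendsto_laplace h0 hV ω).mul hpow).congr' ?_)
  -- For `ε > 0` the identity is exact: the fractional integral contributes `s^(α-2)` and the four
  -- derivatives `s^4`.
  filter_upwards [self_mem_nhdsWithin] with ε hε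
  set s : ℂ := ε + 2 * Real.pi * ω * Complex.I
  have hs : 0 < s.re := by simpa [s] using hε
  have hs0 : s ≠ 0 := by intro h; simp [h] at hs
  have h1 := (integrable_and_laplace_of_eq_integral_rlKernel (r := 2 - α) (by linarith [hα.2]) hs
    (integrable_cexp_mul h0 hV hs.le) (fracIntLine_eq_integral_rlKernel α V)).2
  have h2 := (integrable_and_laplace_iteratedDeriv hs hF0 4 (by exact_mod_cast hF)
    (integrable_cexp_mul hg0 hg hs.le)).2
  change _ = laplace (iteratedDeriv 4 (fracIntLine α V)) s
  rw [h2, h1, mul_assoc, ← Complex.cpow_natCast s 4, ← Complex.cpow_add _ _ hs0]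
  congr 2
  push_cast
  ring

/-! ### Fourier inversion for smooth functions on the line -/

theorem continuous_fourier_of_integrable {f : ℝ → ℂ} (hf : MeasureTheory.Integrable f) :
    Continuous (𝓕 f) :=
  VectorFourier.fourierIntegral_continuous Real.continuous_fourierChar
    (by exact continuous_inner) hf

theorem norm_fourier_le {f : ℝ → ℂ} (ω : ℝ) : ‖𝓕 f ω‖ ≤ ∫ x, ‖f x‖ :=
  VectorFourier.norm_fourierIntegral_le_integral_norm _ _ _ _ _

theorem fourierInv_eq_integral_cexp (f : ℝ → ℂ) (x : ℝ) :
    𝓕⁻ f x = ∫ ω : ℝ, Complex.exp (2 * Real.pi * ω * Complex.I * x) * f ω := by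
  rw [Real.fourierInv_eq']
  congr 1
  ext ω
  rw [smul_eq_mul]
  congr 2
  simp
  ring

theorem norm_cexp_two_pi_mul_I (ω x : ℝ) :
    ‖Complex.exp (2 * Real.pi * ω * Complex.I * x)‖ = 1 := by
  rw [Complex.norm_exp]; simp

theorem hasDerivAt_fourierInv {f : ℝ → ℂ} (hf : MeasureTheory.Integrable f)
    (hf' : MeasureTheory.Integrable fun ω : ℝ => (2 * Real.pi * ω * Complex.I : ℂ) * f ω) (x : ℝ) :
    HasDerivAt (𝓕⁻ f) (𝓕⁻ (fun ω : ℝ => (2 * Real.pi * ω * Complex.I : ℂ) * f ω) x) x := by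
  have hpi : (2 * Real.pi * Complex.I : ℂ) ≠ 0 := by simp [Real.pi_ne_zero]
  have h1 : MeasureTheory.Integrable fun ω : ℝ => ω • f ω := by
    refine (hf'.const_mul (2 * Real.pi * Complex.I : ℂ)⁻¹).congr
      (Filter.Eventually.of_forall fun ω => ?_)
    simp only [Complex.real_smul]
    field_simp
  have h2 := (Real.hasDerivAt_fourier hf h1 (-x)).scomp x (hasDerivAt_neg x)
  have h3 : (𝓕 f ∘ Neg.neg) = 𝓕⁻ f := by
    ext y
    rw [Real.fourierInv_eq_fourier_neg]
    rfl
  rw [h3] at h2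
  suffices h4 : 𝓕⁻ (fun ω : ℝ => (2 * Real.pi * ω * Complex.I : ℂ) * f ω) x =
      (-1 : ℝ) • 𝓕 (fun x : ℝ => (-2 * Real.pi * Complex.I * x : ℂ) • f x) (-x) by
    rw [h4]
    exact h2
  rw [Real.fourierInv_eq_fourier_neg, neg_one_smul, Real.fourier_real_eq, Real.fourier_real_eq,
    ← MeasureTheory.integral_neg]
  congr 1
  ext ω
  rw [← smul_neg, smul_eq_mul]
  congr 1
  ring

/-- A function smooth enough for the truncation error estimate, extended to the line. -/
structure LineSmooth (a α : ℝ) (V : ℝ → ℝ) : Prop where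
  hα : α ∈ Set.Ioo (1 : ℝ) 2
  cont : Continuous V
  zero : ∀ x ≤ a, V x = 0
  int : MeasureTheory.Integrable V
  contDiff : ContDiff ℝ 4 (fracIntLine α V)
  intDeriv : MeasureTheory.Integrable (lineDerivAddTwo α V)
  intFourier : MeasureTheory.Integrable (𝓕 (fun x : ℝ => (lineDerivAddTwo α V x : ℂ)))

namespace LineSmooth

variable {a α : ℝ} {V : ℝ → ℝ}

theorem norm_fourier_mul_rpow (h : LineSmooth a α V) {ω : ℝ} (hω : ω ≠ 0) :
    ‖𝓕 (fun x : ℝ => (V x : ℂ)) ω‖ * ‖(2 * Real.pi * ω * Complex.I : ℂ)‖ ^ (α + 2) =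
      ‖𝓕 (fun x : ℝ => (lineDerivAddTwo α V x : ℂ)) ω‖ := by
  rw [fourier_lineDerivAddTwo h.hα h.zero h.int h.contDiff h.intDeriv hω,
    norm_mul (𝓕 (fun x : ℝ => (V x : ℂ)) ω), show (α : ℂ) + 2 = ((α + 2 : ℝ) : ℂ) by push_cast; rfl,
    Complex.norm_cpow_real]

theorem ae_norm_fourier_mul_rpow (h : LineSmooth a α V) : ∀ᵐ ω : ℝ,
    ‖𝓕 (fun x : ℝ => (V x : ℂ)) ω‖ * ‖(2 * Real.pi * ω * Complex.I : ℂ)‖ ^ (α + 2) =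
      ‖𝓕 (fun x : ℝ => (lineDerivAddTwo α V x : ℂ)) ω‖ := by
  filter_upwards [MeasureTheory.Measure.ae_ne MeasureTheory.volume (0 : ℝ)] with ω hω
  exact h.norm_fourier_mul_rpow hω

/-- On `[-1, 1]` the transform is bounded by the `L¹` norm of `V`; outside, `|2πω| ≥ 1`, so it is
dominated by the transform of the derivative of order `α + 2`. -/
theorem integrable_fourier (h : LineSmooth a α V) :
    MeasureTheory.Integrable (𝓕 (fun x : ℝ => (V x : ℂ))) := by
  have hc := continuous_fourier_of_integrable (f := fun x : ℝ => (V x : ℂ)) h.int.ofReal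
  set B := ∫ x, ‖(V x : ℂ)‖
  have hi : MeasureTheory.Integrable (Set.indicator (Set.Icc (-1 : ℝ) 1) fun _ => B) := by
    rw [MeasureTheory.integrable_indicator_iff measurableSet_Icc]
    exact MeasureTheory.integrableOn_const (by simp)
  refine (hi.add h.intFourier.norm).mono' hc.aestronglyMeasurable
    (Filter.Eventually.of_forall fun ω => ?_)
  simp only [Pi.add_apply]
  by_cases hω : ω ∈ Set.Icc (-1 : ℝ) 1
  · rw [Set.indicator_of_mem hω]
    exact (norm_fourier_le ω).trans (le_add_of_nonneg_right (norm_nonneg _))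
  · rw [Set.indicator_of_notMem hω, zero_add]
    have hω1 : 1 < |ω| := by
      rw [← not_le, abs_le]
      exact hω
    have hω0 : ω ≠ 0 := by rintro rfl; simp at hω1; linarith
    rw [← h.norm_fourier_mul_rpow hω0]
    refine le_mul_of_one_le_right (norm_nonneg _) (Real.one_le_rpow ?_ (by linarith [h.hα.1]))
    have : ‖(2 * Real.pi * ω * Complex.I : ℂ)‖ = 2 * Real.pi * |ω| := by
      simp [Real.pi_pos.le]
    rw [this]
    nlinarith [Real.pi_gt_three]

theorem integrable_mul_fourier (h : LineSmooth a α V) {m : ℝ → ℂ} (hm : Measurable m) {B : ℝ}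
    (hB : ∀ ω : ℝ, ‖m ω‖ ≤ B * (1 + ‖(2 * Real.pi * ω * Complex.I : ℂ)‖ ^ (α + 2))) :
    MeasureTheory.Integrable fun ω => m ω * 𝓕 (fun x : ℝ => (V x : ℂ)) ω := by
  refine ((h.integrable_fourier.norm.add h.intFourier.norm).const_mul B).mono'
    (hm.aestronglyMeasurable.mul h.integrable_fourier.aestronglyMeasurable) ?_
  filter_upwards [h.ae_norm_fourier_mul_rpow] with ω hω
  rw [norm_mul, Pi.add_apply, ← hω]
  calc _ ≤ B * (1 + ‖(2 * Real.pi * ω * Complex.I : ℂ)‖ ^ (α + 2)) *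
        ‖𝓕 (fun x : ℝ => (V x : ℂ)) ω‖ := by gcongr; exact hB ω
    _ = _ := by ring

theorem rpow_le_one_add_rpow {t r p : ℝ} (ht : 0 ≤ t) (hr : 0 ≤ r) (hrp : r ≤ p) :
    t ^ r ≤ 1 + t ^ p := by
  rcases le_total t 1 with h | h
  · exact (Real.rpow_le_one ht h hr).trans (le_add_of_nonneg_right (Real.rpow_nonneg ht _))
  · exact (Real.rpow_le_rpow_of_exponent_le h hrp).trans (by linarith)

theorem integrable_cpow_mul_fourier (h : LineSmooth a α V) {r : ℝ} (hr : 0 ≤ r) (hr' : r ≤ α + 2) :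
    MeasureTheory.Integrable fun ω : ℝ => (2 * Real.pi * ω * Complex.I : ℂ) ^ (r : ℂ) *
      𝓕 (fun x : ℝ => (V x : ℂ)) ω := by
  refine h.integrable_mul_fourier (B := 1) (by fun_prop) fun ω => ?_
  rw [Complex.norm_cpow_real, one_mul]
  exact rpow_le_one_add_rpow (norm_nonneg _) hr hr'

theorem hasDerivAt_fourierInv_cpow (h : LineSmooth a α V) {r : ℝ} (hr : 0 < r)
    (hr' : r + 1 ≤ α + 2) (x : ℝ) :
    HasDerivAt (𝓕⁻ fun ω : ℝ => (2 * Real.pi * ω * Complex.I : ℂ) ^ (r : ℂ) *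
      𝓕 (fun x : ℝ => (V x : ℂ)) ω)
      (𝓕⁻ (fun ω : ℝ => (2 * Real.pi * ω * Complex.I : ℂ) ^ ((r + 1 : ℝ) : ℂ) *
      𝓕 (fun x : ℝ => (V x : ℂ)) ω) x) x := by
  have e : (fun ω : ℝ => (2 * Real.pi * ω * Complex.I : ℂ) ^ ((r + 1 : ℝ) : ℂ) *
      𝓕 (fun x : ℝ => (V x : ℂ)) ω) = fun ω : ℝ => (2 * Real.pi * ω * Complex.I : ℂ) *
        ((2 * Real.pi * ω * Complex.I : ℂ) ^ (r : ℂ) * 𝓕 (fun x : ℝ => (V x : ℂ)) ω) := by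
    ext ω
    rw [← mul_assoc]
    congr 1
    rcases eq_or_ne ω 0 with rfl | hω
    · have : ((r + 1 : ℝ) : ℂ) ≠ 0 := by exact_mod_cast (by linarith : r + 1 ≠ 0)
      simp only [Complex.ofReal_zero, mul_zero, zero_mul]
      exact Complex.zero_cpow this
    · have : (2 * Real.pi * ω * Complex.I : ℂ) ≠ 0 := by simp [hω, Real.pi_ne_zero]
      rw [Complex.ofReal_add, Complex.cpow_add _ _ this, Complex.ofReal_one, Complex.cpow_one,
        mul_comm]
  have h1 := h.integrable_cpow_mul_fourier (r := r) hr.le (by linarith)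
  have h2 := h.integrable_cpow_mul_fourier (r := r + 1) (by linarith) hr'
  rw [e] at h2 ⊢
  exact hasDerivAt_fourierInv h1 h2 x

/-- Riemann–Lebesgue; it determines the constants of integration in `iteratedDeriv_two_eq`. -/
theorem tendsto_fourierInv_atBot (f : ℝ → ℂ) :
    Filter.Tendsto (𝓕⁻ f) Filter.atBot (nhds 0) := by
  have h1 : Filter.Tendsto (fun x : ℝ => 𝓕 f (-x)) Filter.atBot (nhds 0) :=
    ((Real.zero_at_infty_fourier f).mono_left atTop_le_cocompact).comp
      Filter.tendsto_neg_atBot_atTop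
  refine h1.congr fun x => ?_
  rw [Real.fourierInv_eq_fourier_neg]

/-- The second derivative of the fractional integral is the inverse Fourier transform of
`(2πiω)^α` times the Fourier transform. -/
theorem iteratedDeriv_two_eq (h : LineSmooth a α V) (x : ℝ) :
    ((iteratedDeriv 2 (fracIntLine α V) x : ℝ) : ℂ) =
      𝓕⁻ (fun ω : ℝ => (2 * Real.pi * ω * Complex.I : ℂ) ^ (α : ℂ) *
        𝓕 (fun x : ℝ => (V x : ℂ)) ω) x := by
  obtain ⟨hα1, hα2⟩ := h.hα
  set F := fracIntLine α V
  have hF4 : ContDiff ℝ (3 + 1 : ℕ) F := by exact_mod_cast h.contDiff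
  have hF3 : ContDiff ℝ (2 + 1 : ℕ) F := hF4.of_le (by norm_num)
  have hF2 : ContDiff ℝ (2 : ℕ) F := hF4.of_le (by norm_num)
  set Φ : ℝ → ℝ → ℂ := fun r => 𝓕⁻ fun ω : ℝ => (2 * Real.pi * ω * Complex.I : ℂ) ^ (r : ℂ) *
        𝓕 (fun x : ℝ => (V x : ℂ)) ω
  -- Inversion is available for the fourth derivative of `F`. Integrating twice gives the second
  -- derivative up to an affine function `p + q y`.
  have hΦ4 : ∀ y, Φ (α + 1 + 1) y = ((iteratedDeriv 4 F y : ℝ) : ℂ) := by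
    intro y
    have h1 := Continuous.fourierInv_fourier_eq (f := fun x : ℝ => (lineDerivAddTwo α V x : ℂ))
      (Complex.continuous_ofReal.comp (hF4.continuous_iteratedDeriv 4 le_rfl)) h.intDeriv.ofReal
      h.intFourier
    have h2 := congrFun h1 y
    simp only [lineDerivAddTwo] at h2
    rw [← h2]
    refine Real.fourierInv_congr_ae ?_ y
    filter_upwards [MeasureTheory.Measure.ae_ne MeasureTheory.volume (0 : ℝ)] with ω hω
    have h3 := fourier_lineDerivAddTwo h.hα h.zero h.int h.contDiff h.intDeriv hω
    simp only [lineDerivAddTwo] at h3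
    rw [h3, mul_comm]
    congr 2
    push_cast
    ring
  have hd1 : ∀ y, HasDerivAt (fun y => ((iteratedDeriv 3 F y : ℝ) : ℂ) - Φ (α + 1) y) 0 y := by
    intro y
    have h1 := (hasDerivAt_iteratedDeriv hF4 y).ofReal_comp.sub
      (h.hasDerivAt_fourierInv_cpow (r := α + 1) (by linarith) (by linarith) y)
    have h2 := hΦ4 y
    simp only [Φ] at h2
    rw [h2, sub_self] at h1
    exact h1
  obtain ⟨q, hq⟩ : ∃ q, ∀ y, ((iteratedDeriv 3 F y : ℝ) : ℂ) - Φ (α + 1) y = q :=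
    ⟨_, fun y => is_const_of_deriv_eq_zero (fun z => (hd1 z).differentiableAt)
      (fun z => (hd1 z).deriv) y 0⟩
  have hd2 : ∀ y : ℝ, HasDerivAt (fun y : ℝ => ((iteratedDeriv 2 F y : ℝ) : ℂ) - Φ α y - q * y)
      0 y := by
    intro y
    have h1 := ((hasDerivAt_iteratedDeriv hF3 y).ofReal_comp.sub
      (h.hasDerivAt_fourierInv_cpow (r := α) (by linarith) (by linarith) y)).sub
      (((hasDerivAt_id y).ofReal_comp).const_mul q)
    have h2 := hq y
    simp only [Φ] at h2
    rw [h2, Complex.ofReal_one, mul_one, sub_self] at h1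
    exact h1
  obtain ⟨p, hp⟩ : ∃ p, ∀ y : ℝ, ((iteratedDeriv 2 F y : ℝ) : ℂ) - Φ α y - q * y = p :=
    ⟨_, fun y => is_const_of_deriv_eq_zero (fun z => (hd2 z).differentiableAt)
      (fun z => (hd2 z).deriv) y 0⟩
  -- Left of `a` the second derivative of `F` vanishes, and `Φ α` tends to `0`; an affine function
  -- with limit `0` at `-∞` is zero.
  have hlim : Filter.Tendsto (fun y : ℝ => p + q * y) Filter.atBot (nhds 0) := by
    have h1 : Filter.Tendsto (fun y : ℝ => -Φ α y) Filter.atBot (nhds 0) := by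
      simpa using (tendsto_fourierInv_atBot _).neg
    refine h1.congr' ?_
    filter_upwards [Filter.eventually_le_atBot a] with y hy
    rw [← hp y, iteratedDeriv_eq_zero_of_le hF2 (fun x hx => fracIntLine_eq_zero h.zero hx) hy]
    simp
  have hq0 : q = 0 := by
    have h1 := (hlim.comp (Filter.tendsto_atBot_add_const_right _ (1 : ℝ) Filter.tendsto_id)).sub
      hlim
    rw [sub_zero] at h1
    refine tendsto_nhds_unique (tendsto_const_nhds.congr fun y => ?_) h1
    simp
    ring
  subst hq0
  have hp0 : p = 0 := by
    refine tendsto_nhds_unique (tendsto_const_nhds.congr fun y => ?_) hlim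
    simp
  have h1 := hp x
  rw [hp0, zero_mul, sub_zero, sub_eq_zero] at h1
  exact h1

end LineSmooth

/-! ### Consistency of the difference on the line -/

namespace LineSmooth

variable {a α : ℝ} {V : ℝ → ℝ}

/-- Each translate is expanded by Fourier inversion; sum and integral commute because both `∑ |w_k|`
and the `L¹` norm of `𝓕 V` are finite. -/
theorem tsum_w_mul_eq_integral (h : LineSmooth a α V) (s x : ℝ) :
    ((∑' k : ℕ, w α k * V (x + (1 - k) * s) : ℝ) : ℂ) =
      ∫ ω : ℝ, (∑' k : ℕ, (w α k : ℂ) * Complex.exp ((1 - k) * (2 * Real.pi * ω * Complex.I * s))) *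
        (Complex.exp (2 * Real.pi * ω * Complex.I * x) * 𝓕 (fun x : ℝ => (V x : ℂ)) ω) := by
  have hV : ∀ y : ℝ, (V y : ℂ) = ∫ ω : ℝ, Complex.exp (2 * Real.pi * ω * Complex.I * y) *
      𝓕 (fun x : ℝ => (V x : ℂ)) ω := by
    intro y
    rw [← fourierInv_eq_integral_cexp]
    exact (congrFun (Continuous.fourierInv_fourier_eq (f := fun x : ℝ => (V x : ℂ))
      (Complex.continuous_ofReal.comp h.cont) h.int.ofReal h.integrable_fourier) y).symm
  set F : ℕ → ℝ → ℂ := fun k ω =>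
    (w α k : ℂ) * Complex.exp ((1 - k) * (2 * Real.pi * ω * Complex.I * s)) *
      (Complex.exp (2 * Real.pi * ω * Complex.I * x) * 𝓕 (fun x : ℝ => (V x : ℂ)) ω)
  have hnorm : ∀ k ω, ‖F k ω‖ = |w α k| * ‖𝓕 (fun x : ℝ => (V x : ℂ)) ω‖ := by
    intro k ω
    simp only [F]
    rw [norm_mul, norm_mul, norm_mul, norm_cexp_two_pi_mul_I, one_mul, Complex.norm_exp,
      Complex.norm_real, Real.norm_eq_abs]
    simp
  have hint : ∀ k, MeasureTheory.Integrable (F k) := by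
    intro k
    refine (h.integrable_fourier.norm.const_mul |w α k|).mono' ?_
      (Filter.Eventually.of_forall fun ω => (hnorm k ω).le)
    exact (by fun_prop : Continuous fun ω : ℝ => (w α k : ℂ) *
      Complex.exp ((1 - k) * (2 * Real.pi * ω * Complex.I * s))).aestronglyMeasurable.mul
      ((by fun_prop : Continuous fun ω : ℝ =>
        Complex.exp (2 * Real.pi * ω * Complex.I * x)).aestronglyMeasurable.mul
        h.integrable_fourier.aestronglyMeasurable)
  have hsum : Summable fun k => ∫ ω, ‖F k ω‖ := by
    simp_rw [hnorm, MeasureTheory.integral_const_mul]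
    exact (summable_abs_w h.hα).mul_right _
  have hF : ∀ k, ∫ ω, F k ω = ((w α k * V (x + (1 - k) * s) : ℝ) : ℂ) := by
    intro k
    rw [Complex.ofReal_mul, hV, ← MeasureTheory.integral_const_mul]
    congr 1
    ext ω
    simp only [F]
    rw [mul_assoc, ← mul_assoc (Complex.exp _), ← Complex.exp_add]
    congr 3
    push_cast
    ring
  have h1 := (MeasureTheory.hasSum_integral_of_summable_integral_norm hint hsum).tsum_eq
  rw [Complex.ofReal_tsum]
  simp_rw [← hF]
  rw [h1]
  congr 1
  ext ω
  simp only [F]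
  rw [tsum_mul_right]

end LineSmooth

/-- Second order consistency of the weighted and shifted Grünwald difference on the line. -/
theorem exists_abs_difference_sub_le {α : ℝ} (hα : α ∈ Set.Ioo (1 : ℝ) 2) :
    ∃ C, 0 ≤ C ∧ ∀ (a : ℝ) (V : ℝ → ℝ), LineSmooth a α V → ∀ s : ℝ, 0 < s → ∀ x : ℝ,
      |(s ^ α)⁻¹ * ∑' k : ℕ, w α k * V (x + (1 - k) * s) - iteratedDeriv 2 (fracIntLine α V) x| ≤
        C * s ^ 2 * ∫ ω : ℝ, ‖𝓕 (fun x : ℝ => (lineDerivAddTwo α V x : ℂ)) ω‖ := by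
  obtain ⟨C, hC0, hC⟩ := exists_norm_symbol_sub_le hα
  refine ⟨C, hC0, fun a V h s hs x => ?_⟩
  have hsα : 0 < s ^ α := Real.rpow_pos_of_pos hs α
  set S : ℝ → ℂ := fun ω => ∑' k : ℕ, (w α k : ℂ) *
    Complex.exp ((1 - k) * (2 * Real.pi * ω * Complex.I * s))
  set E : ℝ → ℂ := fun ω => Complex.exp (2 * Real.pi * ω * Complex.I * x)
  have hSn : ∀ ω, ‖S ω‖ ≤ ∑' k, |w α k| := by
    intro ω
    have hk : ∀ k : ℕ, ‖(w α k : ℂ) * Complex.exp ((1 - k) * (2 * Real.pi * ω * Complex.I * s))‖ =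
        |w α k| := by
      intro k
      rw [norm_mul, Complex.norm_exp]
      simp
    refine (norm_tsum_le_tsum_norm ?_).trans_eq (by simp only [hk])
    simpa only [hk] using summable_abs_w hα
  have hS : Measurable S := by
    refine Continuous.measurable (continuous_tsum (fun k => by fun_prop) (summable_abs_w hα)
      fun k ω => ?_)
    rw [norm_mul, Complex.norm_exp]
    simp
  have hE : Continuous E := by fun_prop
  have hEn : ∀ ω, ‖E ω‖ = 1 := fun ω => norm_cexp_two_pi_mul_I ω x
  have hi1 : MeasureTheory.Integrable fun ω => S ω * (E ω * 𝓕 (fun x : ℝ => (V x : ℂ)) ω) := by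
    have := h.integrable_mul_fourier (m := fun ω => S ω * E ω) (B := ∑' k, |w α k|)
      (hS.mul hE.measurable) fun ω => by
        rw [norm_mul, hEn, mul_one]
        exact (hSn ω).trans (le_mul_of_one_le_right (tsum_nonneg fun k => abs_nonneg _)
          (le_add_of_nonneg_right (by positivity)))
    simpa only [mul_assoc] using this
  have hi2 : MeasureTheory.Integrable fun ω : ℝ =>
      Complex.exp (2 * Real.pi * ω * Complex.I * x) * ((2 * Real.pi * ω * Complex.I : ℂ) ^ (α : ℂ) *
        𝓕 (fun x : ℝ => (V x : ℂ)) ω) := by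
    refine (h.integrable_cpow_mul_fourier (r := α) (by linarith [hα.1]) (by linarith)).norm.mono'
      (hE.aestronglyMeasurable.mul (h.integrable_cpow_mul_fourier (r := α) (by linarith [hα.1])
        (by linarith)).aestronglyMeasurable) (Filter.Eventually.of_forall fun ω => ?_)
    rw [norm_mul, norm_cexp_two_pi_mul_I, one_mul]
  have hkey : (((s ^ α)⁻¹ * ∑' k : ℕ, w α k * V (x + (1 - k) * s) -
      iteratedDeriv 2 (fracIntLine α V) x : ℝ) : ℂ) =
      ∫ ω : ℝ, (((s ^ α)⁻¹ : ℝ) * (S ω * (E ω * 𝓕 (fun x : ℝ => (V x : ℂ)) ω)) -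
        E ω * ((2 * Real.pi * ω * Complex.I : ℂ) ^ (α : ℂ) * 𝓕 (fun x : ℝ => (V x : ℂ)) ω)) := by
    rw [MeasureTheory.integral_sub (hi1.const_mul _) hi2, MeasureTheory.integral_const_mul,
      Complex.ofReal_sub, Complex.ofReal_mul, h.tsum_w_mul_eq_integral, h.iteratedDeriv_two_eq,
      fourierInv_eq_integral_cexp]
  rw [← Real.norm_eq_abs, ← Complex.norm_real, hkey, ← MeasureTheory.integral_const_mul]
  refine MeasureTheory.norm_integral_le_of_norm_le (h.intFourier.norm.const_mul _) ?_
  filter_upwards [h.ae_norm_fourier_mul_rpow,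
    MeasureTheory.Measure.ae_ne MeasureTheory.volume (0 : ℝ)] with ω hω hω0
  rw [← hω]
  set z : ℂ := 2 * Real.pi * ω * Complex.I
  have hz0 : z ≠ 0 := by simp [z, hω0, Real.pi_ne_zero]
  have hs0 : (s : ℂ) ≠ 0 := by exact_mod_cast hs.ne'
  -- The symbol bound at `z s` carries `s^(α+2)`; the prefactor `s^(-α)` leaves `s²`.
  have h1 := hC (z * s) (by simp [z]) (mul_ne_zero hz0 hs0)
  have hpow : (z * s) ^ (α : ℂ) = z ^ (α : ℂ) * (s ^ α : ℝ) := by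
    rw [cpow_mul_of_re_eq_zero hz0 (by simp [z]) (by simpa using hs), Complex.ofReal_cpow hs.le]
  have hne : ((s ^ α : ℝ) : ℂ) ≠ 0 := by exact_mod_cast hsα.ne'
  have e : (((s ^ α)⁻¹ : ℝ) : ℂ) * (S ω * (E ω * 𝓕 (fun x : ℝ => (V x : ℂ)) ω)) -
      E ω * (z ^ (α : ℂ) * 𝓕 (fun x : ℝ => (V x : ℂ)) ω) =
      ((s ^ α : ℝ) : ℂ)⁻¹ * (S ω - (z * s) ^ (α : ℂ)) *
        (E ω * 𝓕 (fun x : ℝ => (V x : ℂ)) ω) := by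
    rw [hpow, Complex.ofReal_inv]
    field_simp
  rw [e, norm_mul, norm_mul, norm_mul, hEn, one_mul, norm_inv, Complex.norm_real,
    Real.norm_of_nonneg hsα.le]
  rw [norm_mul, Complex.norm_real, Real.norm_of_nonneg hs.le,
    Real.mul_rpow (norm_nonneg _) hs.le] at h1
  have hs2 : s ^ (α + 2) = s ^ α * s ^ 2 := by
    rw [Real.rpow_add hs]
    norm_num
  calc _ ≤ (s ^ α)⁻¹ * (C * (‖z‖ ^ (α + 2) * s ^ (α + 2))) * ‖𝓕 (fun x : ℝ => (V x : ℂ)) ω‖ := by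
        gcongr
    _ = _ := by
        rw [hs2]
        field_simp

/-! ### From the line to the grid on an interval -/

/-- For upper limits near `x` the two integrals agree, since `V` is `v` on `[a, b]` and zero before;
values beyond `b` never enter. -/
theorem rlDeriv_eq_iteratedDeriv_fracIntLine {a b α x : ℝ} {v V : ℝ → ℝ} (h0 : ∀ x ≤ a, V x = 0)
    (hv : ∀ x ∈ Set.Icc a b, V x = v x) (hx : x ∈ Set.Ioo a b) :
    rlDeriv a α v x = iteratedDeriv 2 (fracIntLine α V) x := by
  rw [rlDeriv]
  refine Filter.EventuallyEq.iteratedDeriv_eq 2 ?_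
  filter_upwards [Ioo_mem_nhds hx.1 hx.2] with z hz
  rw [fracInt, fracIntLine]
  congr 1
  rw [intervalIntegral.integral_of_le hz.1.le, MeasureTheory.integral_Ioc_eq_integral_Ioo]
  have h1 : ∫ ξ in Set.Ioo a z, v ξ / (z - ξ) ^ (α - 1) =
      ∫ ξ in Set.Ioo a z, V ξ / (z - ξ) ^ (α - 1) := by
    refine MeasureTheory.setIntegral_congr_fun measurableSet_Ioo fun ξ hξ => ?_
    rw [hv ξ ⟨hξ.1.le, (hξ.2.trans hz.2).le⟩]
  rw [h1]
  refine (MeasureTheory.setIntegral_eq_of_subset_of_forall_sdiff_eq_zero measurableSet_Iio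
    (fun ξ hξ => hξ.2) fun ξ hξ => ?_).symm
  have : ξ ≤ a := by
    by_contra hlt
    exact hξ.2 ⟨not_le.1 hlt, hξ.1⟩
  rw [h0 ξ this, zero_div]

theorem G_mulVec_eq_tsum {α a s : ℝ} {M : ℕ} {V : ℝ → ℝ} (hs : 0 ≤ s) (h0 : ∀ x ≤ a, V x = 0)
    (hM : V (a + (M + 1) * s) = 0) (i : Fin M) :
    (G α M *ᵥ fun k => V (a + ((k : ℕ) + 1) * s)) i =
      ∑' k : ℕ, w α k * V (a + ((i : ℕ) + 1) * s + (1 - k) * s) := by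
  -- For `k ≥ i + 2` the evaluation point is at or left of `a`, so these terms vanish.
  rw [tsum_eq_sum (s := Finset.range ((i : ℕ) + 2)), ← Finset.sum_range_reflect]
  · simp only [Matrix.mulVec, dotProduct, G, Matrix.of_apply]
    rw [Fin.sum_univ_eq_sum_range (fun k => (if k ≤ (i : ℕ) + 1 then w α ((i : ℕ) + 1 - k) else 0) *
      V (a + (k + 1) * s)) M]
    -- The shift makes the last row reach the right endpoint, a column absent from the matrix; `hM`
    -- allows it to be added.
    have h1 : ∑ k ∈ Finset.range M, (if k ≤ (i : ℕ) + 1 then w α ((i : ℕ) + 1 - k) else 0) *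
        V (a + (k + 1) * s) = ∑ k ∈ Finset.range (M + 1),
          (if k ≤ (i : ℕ) + 1 then w α ((i : ℕ) + 1 - k) else 0) * V (a + (k + 1) * s) := by
      rw [Finset.sum_range_succ, hM, mul_zero, add_zero]
    have h2 : Finset.range ((i : ℕ) + 2) ⊆ Finset.range (M + 1) :=
      Finset.range_subset_range.2 (by omega)
    rw [h1, ← Finset.sum_subset h2]
    · refine Finset.sum_congr rfl fun k hk => ?_
      have hk : k ≤ (i : ℕ) + 1 := by
        have := Finset.mem_range.1 hk
        omega
      rw [if_pos hk, show (i : ℕ) + 2 - 1 - k = (i : ℕ) + 1 - k by omega]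
      congr 2
      push_cast [Nat.cast_sub hk]
      ring
    · intro k _ hk
      rw [if_neg (by rw [Finset.mem_range] at hk; omega), zero_mul]
  · intro k hk
    have hk : (i : ℕ) + 2 ≤ k := by simpa using hk
    have hk' : ((i : ℕ) : ℝ) + 2 ≤ k := by exact_mod_cast hk
    rw [h0, mul_zero]
    nlinarith

/-- Truncation error of the matrix `G_α` at the interior grid points. -/
theorem exists_abs_G_mulVec_sub_rlDeriv_le {α : ℝ} (hα : α ∈ Set.Ioo (1 : ℝ) 2) :
    ∃ C, 0 ≤ C ∧ ∀ (a b K : ℝ) (v : ℝ → ℝ), a < b → SpaceSmooth a b α K v → v b = 0 →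
      ∀ (M : ℕ) (s : ℝ), s = (b - a) / (M + 1) → ∀ i : Fin M,
        |(s ^ α)⁻¹ * (G α M *ᵥ fun k => v (a + ((k : ℕ) + 1) * s)) i -
          rlDeriv a α v (a + ((i : ℕ) + 1) * s)| ≤ C * s ^ 2 * K := by
  obtain ⟨C, hC0, hC⟩ := exists_abs_difference_sub_le hα
  refine ⟨C, hC0, fun a b K v hab hsm hvb M s hs i => ?_⟩
  obtain ⟨V, hVc, hV0, hVv, hVi, hVd, hg, hgf, hK⟩ := hsm
  have hM : (0 : ℝ) < M + 1 := by positivity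
  have hs0 : 0 < s := by rw [hs]; exact div_pos (sub_pos.2 hab) hM
  have hb : a + (M + 1) * s = b := by rw [hs]; field_simp; ring
  have hmem : ∀ k : Fin M, a + ((k : ℕ) + 1) * s ∈ Set.Ioo a b := by
    intro k
    have hk : ((k : ℕ) : ℝ) + 1 ≤ M := by exact_mod_cast k.2
    constructor
    · have : 0 < (((k : ℕ) : ℝ) + 1) * s := by positivity
      linarith
    · rw [← hb]
      nlinarith
  have hVb : V (a + (M + 1) * s) = 0 := by
    rw [hb, hVv b ⟨hab.le, le_rfl⟩, hvb]
  have h1 := hC a V ⟨hα, hVc, hV0, hVi, hVd, hg, hgf⟩ s hs0 (a + ((i : ℕ) + 1) * s)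
  rw [← G_mulVec_eq_tsum hs0.le hV0 hVb, ← rlDeriv_eq_iteratedDeriv_fracIntLine hV0 hVv (hmem i)]
    at h1
  have h2 : (fun k : Fin M => V (a + ((k : ℕ) + 1) * s)) =
      fun k : Fin M => v (a + ((k : ℕ) + 1) * s) :=
    funext fun k => hVv _ (Set.Ioo_subset_Icc_self (hmem k))
  rw [h2] at h1
  exact h1.trans (by gcongr)

/-! ### Differences in time -/

theorem abs_add_sub_two_mul_le {T K : ℝ} {f f' f'' : ℝ → ℝ}
    (hf : ∀ t ∈ Set.Icc 0 T, HasDerivWithinAt f (f' t) (Set.Icc 0 T) t)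
    (hf' : ∀ t ∈ Set.Icc 0 T, HasDerivWithinAt f' (f'' t) (Set.Icc 0 T) t)
    (hK : ∀ t ∈ Set.Icc 0 T, |f'' t| ≤ K) {m s : ℝ} (hs : 0 ≤ s) (h0 : 0 ≤ m - s)
    (hT : m + s ≤ T) : |f (m + s) + f (m - s) - 2 * f m| ≤ 2 * K * s ^ 2 := by
  have hadd : Set.MapsTo (fun r => m + r) (Set.Icc 0 s) (Set.Icc 0 T) := fun r hr =>
    ⟨by linarith [hr.1], by linarith [hr.2]⟩
  have hsub : Set.MapsTo (fun r => m - r) (Set.Icc 0 s) (Set.Icc 0 T) := fun r hr =>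
    ⟨by linarith [hr.2], by linarith [hr.1]⟩
  have hK0 : 0 ≤ K := (abs_nonneg _).trans (hK m ⟨by linarith, by linarith⟩)
  have h1 : ∀ r ∈ Set.Icc 0 s, HasDerivWithinAt (fun r => f (m + r) + f (m - r))
      (f' (m + r) - f' (m - r)) (Set.Icc 0 s) r := by
    intro r hr
    have ha := (hf _ (hadd hr)).comp r ((hasDerivWithinAt_id r _).const_add m) hadd
    have hb := (hf _ (hsub hr)).comp r ((hasDerivWithinAt_id r _).const_sub m) hsub
    have := ha.add hb
    rw [mul_one, mul_neg_one, ← sub_eq_add_neg] at this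
    exact this
  -- The derivative in `r` is `f' (m + r) - f' (m - r)`, at most `2Kr ≤ 2Ks` by the mean value
  -- inequality.
  have h2 := norm_image_sub_le_of_norm_deriv_le_segment' h1 (C := 2 * K * s) (fun r hr => by
    have hr' : r ∈ Set.Icc 0 s := Set.Ico_subset_Icc_self hr
    have := (convex_Icc (0 : ℝ) T).norm_image_sub_le_of_norm_hasDerivWithin_le hf'
      (fun t ht => hK t ht) (hsub hr') (hadd hr')
    refine this.trans ?_
    rw [show m + r - (m - r) = 2 * r by ring, Real.norm_of_nonneg (by linarith [hr'.1])]
    nlinarith [hr'.2]) s ⟨hs, le_rfl⟩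
  simp only [add_zero, sub_zero, Real.norm_eq_abs] at h2
  rw [two_mul (f m)]
  refine h2.trans (le_of_eq (by ring))

/-- As a function of the half width `r`, the defect has derivative `f' (m + r) + f' (m - r) - 2 f'
m`, which the averaging estimate for `f'` controls. -/
theorem abs_sub_sub_two_mul_le {T K : ℝ} {f f' f'' f''' : ℝ → ℝ}
    (hf : ∀ t ∈ Set.Icc 0 T, HasDerivWithinAt f (f' t) (Set.Icc 0 T) t)
    (hf' : ∀ t ∈ Set.Icc 0 T, HasDerivWithinAt f' (f'' t) (Set.Icc 0 T) t)
    (hf'' : ∀ t ∈ Set.Icc 0 T, HasDerivWithinAt f'' (f''' t) (Set.Icc 0 T) t)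
    (hK : ∀ t ∈ Set.Icc 0 T, |f''' t| ≤ K) {m s : ℝ} (hs : 0 ≤ s) (h0 : 0 ≤ m - s)
    (hT : m + s ≤ T) : |f (m + s) - f (m - s) - 2 * s * f' m| ≤ 2 * K * s ^ 3 := by
  have hadd : Set.MapsTo (fun r => m + r) (Set.Icc 0 s) (Set.Icc 0 T) := fun r hr =>
    ⟨by linarith [hr.1], by linarith [hr.2]⟩
  have hsub : Set.MapsTo (fun r => m - r) (Set.Icc 0 s) (Set.Icc 0 T) := fun r hr =>
    ⟨by linarith [hr.2], by linarith [hr.1]⟩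
  have hK0 : 0 ≤ K := (abs_nonneg _).trans (hK m ⟨by linarith, by linarith⟩)
  have h1 : ∀ r ∈ Set.Icc 0 s, HasDerivWithinAt (fun r => f (m + r) - f (m - r) - 2 * f' m * r)
      (f' (m + r) + f' (m - r) - 2 * f' m) (Set.Icc 0 s) r := by
    intro r hr
    have ha := (hf _ (hadd hr)).comp r ((hasDerivWithinAt_id r _).const_add m) hadd
    have hb := (hf _ (hsub hr)).comp r ((hasDerivWithinAt_id r _).const_sub m) hsub
    have := (ha.sub hb).sub ((hasDerivWithinAt_id r (Set.Icc 0 s)).const_mul (2 * f' m))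
    rw [mul_one, mul_neg_one, mul_one, sub_neg_eq_add] at this
    exact this
  have h2 := norm_image_sub_le_of_norm_deriv_le_segment' h1 (C := 2 * K * s ^ 2) (fun r hr => by
    refine (abs_add_sub_two_mul_le hf' hf'' hK hr.1 (by linarith [hr.2])
      (by linarith [hr.2])).trans ?_
    have := hr.1
    have := hr.2
    gcongr) s ⟨hs, le_rfl⟩
  simp only [add_zero, sub_zero, mul_zero, sub_self, Real.norm_eq_abs] at h2
  rw [show 2 * s * f' m = 2 * f' m * s by ring]
  exact h2.trans (le_of_eq (by ring))

theorem hasDerivWithinAt_iteratedDerivWithin {T : ℝ} (hT : 0 < T) {n k : ℕ} (hk : k < n) {f : ℝ → ℝ}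
    (hf : ContDiffOn ℝ n f (Set.Icc 0 T)) {t : ℝ} (ht : t ∈ Set.Icc 0 T) :
    HasDerivWithinAt (iteratedDerivWithin k f (Set.Icc 0 T))
      (iteratedDerivWithin (k + 1) f (Set.Icc 0 T) t) (Set.Icc 0 T) t := by
  rw [iteratedDerivWithin_succ]
  exact (hf.differentiableOn_iteratedDerivWithin (by exact_mod_cast hk)
    (uniqueDiffOn_Icc hT) t ht).hasDerivWithinAt

/-- Truncation error of the average of two values. -/
theorem abs_add_sub_two_mul_le_of_contDiffOn {T K : ℝ} (hT : 0 < T) {f : ℝ → ℝ}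
    (hf : ContDiffOn ℝ 2 f (Set.Icc 0 T))
    (hK : ∀ t ∈ Set.Icc 0 T, |iteratedDerivWithin 2 f (Set.Icc 0 T) t| ≤ K) {m s : ℝ} (hs : 0 ≤ s)
    (h0 : 0 ≤ m - s) (hm : m + s ≤ T) : |f (m + s) + f (m - s) - 2 * f m| ≤ 2 * K * s ^ 2 := by
  have hf2 : ContDiffOn ℝ (2 : ℕ) f (Set.Icc 0 T) := by exact_mod_cast hf
  have h1 := fun t ht => hasDerivWithinAt_iteratedDerivWithin hT (k := 0) (by norm_num) hf2 (t := t) ht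
  rw [iteratedDerivWithin_zero] at h1
  exact abs_add_sub_two_mul_le h1
    (fun t ht => hasDerivWithinAt_iteratedDerivWithin hT (k := 1) (by norm_num) hf2 ht) hK hs h0 hm

/-- Truncation error of the central difference quotient. -/
theorem abs_sub_sub_two_mul_le_of_contDiffOn {T K c : ℝ} (hT : 0 < T) {f : ℝ → ℝ}
    (hf : ContDiffOn ℝ 3 f (Set.Icc 0 T))
    (hK : ∀ t ∈ Set.Icc 0 T, |iteratedDerivWithin 3 f (Set.Icc 0 T) t| ≤ K) {m s : ℝ} (hs : 0 ≤ s)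
    (h0 : 0 ≤ m - s) (hm : m + s ≤ T) (hc : HasDerivWithinAt f c (Set.Icc 0 T) m) :
    |f (m + s) - f (m - s) - 2 * s * c| ≤ 2 * K * s ^ 3 := by
  have hf3 : ContDiffOn ℝ (3 : ℕ) f (Set.Icc 0 T) := by exact_mod_cast hf
  have hmem : m ∈ Set.Icc 0 T := ⟨by linarith, by linarith⟩
  have h1 := fun t ht => hasDerivWithinAt_iteratedDerivWithin hT (k := 0) (by norm_num) hf3 (t := t) ht
  rw [iteratedDerivWithin_zero] at h1
  have h2 : c = iteratedDerivWithin 1 f (Set.Icc 0 T) m := by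
    rw [← hc.derivWithin (uniqueDiffOn_Icc hT m hmem), iteratedDerivWithin_one]
  rw [h2]
  exact abs_sub_sub_two_mul_le h1
    (fun t ht => hasDerivWithinAt_iteratedDerivWithin hT (k := 1) (by norm_num) hf3 ht)
    (fun t ht => hasDerivWithinAt_iteratedDerivWithin hT (k := 2) (by norm_num) hf3 ht) hK hs h0 hm

/-! ### Energy estimate -/

section Energy

variable {ι : Type*} [Fintype ι]

theorem dotProduct_mulVec_nonpos_of_symPart {X : Matrix ι ι ℝ} (hX : (-symPart X).PosSemidef)
    (v : ι → ℝ) : v ⬝ᵥ X *ᵥ v ≤ 0 := by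
  have h := hX.dotProduct_mulVec_nonneg v
  have h1 : v ⬝ᵥ Xᵀ *ᵥ v = v ⬝ᵥ X *ᵥ v := by
    rw [Matrix.mulVec_transpose, dotProduct_comm, Matrix.dotProduct_mulVec]
  rw [symPart, Matrix.neg_mulVec, Matrix.smul_mulVec, Matrix.add_mulVec, dotProduct_neg,
    dotProduct_smul, dotProduct_add, star_trivial, h1, smul_eq_mul] at h
  linarith

theorem norm_toLp_sq (v : ι → ℝ) : ‖WithLp.toLp 2 v‖ ^ 2 = v ⬝ᵥ v := by
  rw [EuclideanSpace.norm_sq_eq]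
  simp [dotProduct, pow_two]

theorem dotProduct_le_norm_mul_norm (v w : ι → ℝ) :
    v ⬝ᵥ w ≤ ‖WithLp.toLp 2 v‖ * ‖WithLp.toLp 2 w‖ := by
  have h := real_inner_le_norm (WithLp.toLp 2 v) (WithLp.toLp 2 w)
  simpa [PiLp.inner_apply, dotProduct, mul_comm] using h

/-- Stability of the Crank-Nicolson step in the norm of `Q = Bᵀ B`. -/
theorem norm_mulVec_crankNicolson_le {B A : Matrix ι ι ℝ}
    (hA : ∀ v, v ⬝ᵥ (Bᵀ * B * A) *ᵥ v ≤ 0) {τ : ℝ} (hτ : 0 < τ) {e₀ e₁ R : ι → ℝ}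
    (h : (1 / τ) • (e₁ - e₀) = A *ᵥ (e₀ + e₁) + R) :
    ‖WithLp.toLp 2 (B *ᵥ e₁)‖ ≤ ‖WithLp.toLp 2 (B *ᵥ e₀)‖ + τ * ‖WithLp.toLp 2 (B *ᵥ R)‖ := by
  have h1 : e₁ - e₀ = τ • (A *ᵥ (e₀ + e₁)) + τ • R := by
    rw [← smul_add, ← h, smul_smul, mul_one_div_cancel hτ.ne', one_smul]
  -- A difference of squares: testing with the sum `e₀ + e₁` is what suits the Crank–Nicolson
  -- average.
  have h2 : ‖WithLp.toLp 2 (B *ᵥ e₁)‖ ^ 2 - ‖WithLp.toLp 2 (B *ᵥ e₀)‖ ^ 2 =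
      (B *ᵥ (e₀ + e₁)) ⬝ᵥ (B *ᵥ (e₁ - e₀)) := by
    rw [norm_toLp_sq, norm_toLp_sq, Matrix.mulVec_add, Matrix.mulVec_sub, add_dotProduct,
      dotProduct_sub, dotProduct_sub, dotProduct_comm (B *ᵥ e₁) (B *ᵥ e₀)]
    ring
  have h3 : (B *ᵥ (e₀ + e₁)) ⬝ᵥ (B *ᵥ (A *ᵥ (e₀ + e₁))) ≤ 0 := by
    refine (le_of_eq ?_).trans (hA (e₀ + e₁))
    rw [← Matrix.mulVec_mulVec, ← Matrix.mulVec_mulVec, Matrix.dotProduct_mulVec _ Bᵀ,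
      Matrix.vecMul_transpose]
  have h4 := dotProduct_le_norm_mul_norm (B *ᵥ (e₀ + e₁)) (B *ᵥ R)
  have h5 : ‖WithLp.toLp 2 (B *ᵥ (e₀ + e₁))‖ ≤
      ‖WithLp.toLp 2 (B *ᵥ e₀)‖ + ‖WithLp.toLp 2 (B *ᵥ e₁)‖ := by
    rw [Matrix.mulVec_add, WithLp.toLp_add]
    exact norm_add_le _ _
  rw [h1, Matrix.mulVec_add B (τ • A *ᵥ (e₀ + e₁)) (τ • R), Matrix.mulVec_smul, Matrix.mulVec_smul, dotProduct_add,
    dotProduct_smul, dotProduct_smul, smul_eq_mul, smul_eq_mul] at h2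
  have h0 := norm_nonneg (WithLp.toLp 2 (B *ᵥ e₀))
  have h0' := norm_nonneg (WithLp.toLp 2 (B *ᵥ e₁))
  have hR := norm_nonneg (WithLp.toLp 2 (B *ᵥ R))
  set a := ‖WithLp.toLp 2 (B *ᵥ e₀)‖
  set b := ‖WithLp.toLp 2 (B *ᵥ e₁)‖
  set r := ‖WithLp.toLp 2 (B *ᵥ R)‖
  have h6 : (b - a) * (a + b) ≤ τ * r * (a + b) := by
    have h7 := h4.trans (mul_le_mul_of_nonneg_right h5 hR)
    have h8 := mul_le_mul_of_nonneg_left h7 hτ.le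
    have h9 := mul_nonpos_of_nonneg_of_nonpos hτ.le h3
    linarith
  rcases (add_nonneg h0 h0').eq_or_lt with hz | hpos
  · have : 0 ≤ τ * r := by positivity
    linarith
  · have := le_of_mul_le_mul_right h6 hpos
    linarith

variable [DecidableEq ι]

open scoped MatrixOrder in
theorem exists_eq_transpose_mul_self {Q : Matrix ι ι ℝ} (hQ : Q.PosSemidef) :
    ∃ B : Matrix ι ι ℝ, Q = Bᵀ * B := by
  obtain ⟨B, hB⟩ := CStarAlgebra.nonneg_iff_eq_star_mul_self.mp hQ.nonneg
  exact ⟨B, by rw [hB, Matrix.star_eq_conjTranspose, Matrix.conjTranspose_eq_transpose_of_trivial]⟩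

theorem dotProduct_mulVec_le_norm_mul (X : Matrix ι ι ℝ) (v : ι → ℝ) :
    v ⬝ᵥ X *ᵥ v ≤ ‖Matrix.toEuclideanCLM (n := ι) (𝕜 := ℝ) X‖ * ‖WithLp.toLp 2 v‖ ^ 2 := by
  refine (dotProduct_le_norm_mul_norm _ _).trans ?_
  have h := (Matrix.toEuclideanCLM (n := ι) (𝕜 := ℝ) X).le_opNorm (WithLp.toLp 2 v)
  rw [Matrix.toEuclideanCLM_toLp] at h
  nlinarith [norm_nonneg (WithLp.toLp 2 v)]

/-- The one-step bound is summed in the norm `‖B v‖`, which is equivalent to `‖v‖` with constants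
`√‖Q‖` and `√‖Q⁻¹‖`; only their product, `√(cond Q)`, survives. -/
theorem norm_le_of_crankNicolson {Q A : Matrix ι ι ℝ} (hQ : Q.PosDef)
    (hA : (-symPart (Q * A)).PosSemidef) {c τ ρ : ℝ} (hc : cond Q ≤ c) (hτ : 0 < τ) {N : ℕ}
    {e : Fin (N + 1) → ι → ℝ} {R : Fin N → ι → ℝ} (h0 : e 0 = 0)
    (h : ∀ n : Fin N, (1 / τ) • (e n.succ - e n.castSucc) = A *ᵥ (e n.castSucc + e n.succ) + R n)
    (hR : ∀ n, ‖WithLp.toLp 2 (R n)‖ ≤ ρ) (hρ : 0 ≤ ρ) (n : Fin (N + 1)) :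
    ‖WithLp.toLp 2 (e n)‖ ≤ √c * ((n : ℕ) * τ * ρ) := by
  obtain ⟨B, hB⟩ := exists_eq_transpose_mul_self hQ.posSemidef
  have hdet : IsUnit Q.det := hQ.isUnit.map Matrix.detMonoidHom
  have hBQ : ∀ v w : ι → ℝ, (B *ᵥ v) ⬝ᵥ (B *ᵥ w) = v ⬝ᵥ Q *ᵥ w := by
    intro v w
    rw [hB, ← Matrix.mulVec_mulVec, Matrix.dotProduct_mulVec _ Bᵀ, Matrix.vecMul_transpose]
  set q := ‖Matrix.toEuclideanCLM (n := ι) (𝕜 := ℝ) Q‖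
  set q' := ‖Matrix.toEuclideanCLM (n := ι) (𝕜 := ℝ) Q⁻¹‖
  have hq : 0 ≤ q := norm_nonneg _
  have hq' : 0 ≤ q' := norm_nonneg _
  have hup : ∀ v, ‖WithLp.toLp 2 (B *ᵥ v)‖ ≤ √q * ‖WithLp.toLp 2 v‖ := by
    intro v
    refine le_of_sq_le_sq ?_ (by positivity)
    rw [norm_toLp_sq, hBQ, mul_pow, Real.sq_sqrt hq]
    exact dotProduct_mulVec_le_norm_mul Q v
  have hlow : ∀ v, ‖WithLp.toLp 2 v‖ ≤ √q' * ‖WithLp.toLp 2 (B *ᵥ v)‖ := by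
    intro v
    -- Cauchy–Schwarz for `v ⬝ᵥ v = (B v) ⬝ᵥ (B Q⁻¹ v)`.
    have h1 : ‖WithLp.toLp 2 v‖ ^ 2 ≤
        ‖WithLp.toLp 2 (B *ᵥ v)‖ * ‖WithLp.toLp 2 (B *ᵥ (Q⁻¹ *ᵥ v))‖ := by
      refine le_trans (le_of_eq ?_) (dotProduct_le_norm_mul_norm _ _)
      rw [hBQ, Matrix.mulVec_mulVec, Matrix.mul_nonsing_inv _ hdet, Matrix.one_mulVec, norm_toLp_sq]
    have h2 : ‖WithLp.toLp 2 (B *ᵥ (Q⁻¹ *ᵥ v))‖ ≤ √q' * ‖WithLp.toLp 2 v‖ := by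
      refine le_of_sq_le_sq ?_ (by positivity)
      rw [norm_toLp_sq, hBQ, Matrix.mulVec_mulVec, Matrix.mul_nonsing_inv _ hdet,
        Matrix.one_mulVec, mul_pow, Real.sq_sqrt hq', dotProduct_comm]
      exact dotProduct_mulVec_le_norm_mul Q⁻¹ v
    rcases (norm_nonneg (WithLp.toLp 2 v)).eq_or_lt with hz | hpos
    · rw [← hz]; positivity
    · refine le_of_mul_le_mul_right ?_ hpos
      rw [← pow_two]
      refine h1.trans ((mul_le_mul_of_nonneg_left h2 (norm_nonneg _)).trans (le_of_eq (by ring)))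
  have hen : ∀ n : Fin (N + 1), ‖WithLp.toLp 2 (B *ᵥ e n)‖ ≤ (n : ℕ) * τ * (√q * ρ) := by
    intro n
    induction n using Fin.induction with
    | zero => simp [h0]
    | succ n ih =>
      have h1 := norm_mulVec_crankNicolson_le (B := B) (fun v => by
        rw [← hB]; exact dotProduct_mulVec_nonpos_of_symPart hA v) hτ (h n)
      have h2 := (hup (R n)).trans (mul_le_mul_of_nonneg_left (hR n) (Real.sqrt_nonneg q))
      have h3 := mul_le_mul_of_nonneg_left h2 hτ.le
      rw [Fin.val_castSucc] at ih
      rw [Fin.val_succ]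
      push_cast
      linarith
  calc ‖WithLp.toLp 2 (e n)‖ ≤ √q' * ((n : ℕ) * τ * (√q * ρ)) :=
        (hlow _).trans (mul_le_mul_of_nonneg_left (hen n) (Real.sqrt_nonneg _))
    _ = √(q * q') * ((n : ℕ) * τ * ρ) := by rw [Real.sqrt_mul hq]; ring
    _ ≤ _ := by gcongr; exact hc

/-- A kernel vector satisfies `v = τ A v`, so `v ⬝ᵥ Q v = τ (v ⬝ᵥ Q A v) ≤ 0`, which forces `v = 0`.
-/
theorem isUnit_one_sub_smul {Q A : Matrix ι ι ℝ} (hQ : Q.PosDef)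
    (hA : (-symPart (Q * A)).PosSemidef) {τ : ℝ} (hτ : 0 < τ) : IsUnit (1 - τ • A) := by
  rw [← Matrix.mulVec_injective_iff_isUnit]
  refine (injective_iff_map_eq_zero (Matrix.mulVecLin (1 - τ • A))).2 fun v hv => ?_
  rw [Matrix.mulVecLin_apply, Matrix.sub_mulVec, Matrix.one_mulVec, Matrix.smul_mulVec,
    sub_eq_zero] at hv
  by_contra hv0
  have h1 := hQ.dotProduct_mulVec_pos hv0
  have h2 := dotProduct_mulVec_nonpos_of_symPart hA v
  rw [star_trivial] at h1
  nth_rewrite 2 [hv] at h1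
  rw [Matrix.mulVec_smul, Matrix.mulVec_mulVec, dotProduct_smul, smul_eq_mul] at h1
  nlinarith

theorem existsUnique_crankNicolson {Q A : Matrix ι ι ℝ} (hQ : Q.PosDef)
    (hA : (-symPart (Q * A)).PosSemidef) {τ : ℝ} (hτ : 0 < τ) (N : ℕ) (u₀ : ι → ℝ)
    (f : ℕ → ι → ℝ) :
    ∃! U : Fin (N + 1) → ι → ℝ, U 0 = u₀ ∧ ∀ n : Fin N,
      (1 / τ) • (U n.succ - U n.castSucc) = A *ᵥ (U n.castSucc + U n.succ) + f n := by
  have hu := isUnit_one_sub_smul hQ hA hτ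
  have hstep : ∀ a b r : ι → ℝ, (1 / τ) • (b - a) = A *ᵥ (a + b) + r ↔
      (1 - τ • A) *ᵥ b = a + τ • (A *ᵥ a + r) := by
    intro a b r
    have e : (1 - τ • A) *ᵥ b - (a + τ • (A *ᵥ a + r)) =
        τ • ((1 / τ) • (b - a) - (A *ᵥ (a + b) + r)) := by
      rw [smul_sub, smul_smul, mul_one_div_cancel hτ.ne', one_smul, Matrix.sub_mulVec,
        Matrix.one_mulVec, Matrix.smul_mulVec, Matrix.mulVec_add, smul_add, smul_add, smul_add]
      abel
    rw [← sub_eq_zero (b := A *ᵥ (a + b) + r), ← sub_eq_zero (b := a + τ • (A *ᵥ a + r)), e,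
      smul_eq_zero, or_iff_right hτ.ne']
  simp_rw [hstep]
  let W : ℕ → ι → ℝ := fun n => Nat.rec u₀
    (fun n v => (1 - τ • A)⁻¹ *ᵥ (v + τ • (A *ᵥ v + f n))) n
  refine ⟨fun n => W n, ⟨rfl, fun n => ?_⟩, fun U hU => ?_⟩
  · change (1 - τ • A) *ᵥ ((1 - τ • A)⁻¹ *ᵥ _) = _
    rw [Matrix.mulVec_mulVec, Matrix.mul_nonsing_inv _ ((Matrix.isUnit_iff_isUnit_det _).1 hu),
      Matrix.one_mulVec]
    rfl
  · funext n
    induction n using Fin.induction with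
    | zero => exact hU.1
    | succ n ih =>
      refine Matrix.mulVec_injective_of_isUnit hu ?_
      rw [hU.2 n, ih]
      change _ = (1 - τ • A) *ᵥ ((1 - τ • A)⁻¹ *ᵥ _)
      rw [Matrix.mulVec_mulVec, Matrix.mul_nonsing_inv _ ((Matrix.isUnit_iff_isUnit_det _).1 hu),
        Matrix.one_mulVec]
      rfl

end Energy

/-! ### Truncation error of the two-dimensional scheme -/

namespace Problem

variable {P : Problem}

theorem Admissible.h₁_pos (hP : P.Admissible) (m : Mesh) : 0 < P.h₁ m :=
  div_pos (sub_pos.2 hP.hx) (by positivity)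

theorem Admissible.h₂_pos (hP : P.Admissible) (m : Mesh) : 0 < P.h₂ m :=
  div_pos (sub_pos.2 hP.hy) (by positivity)

theorem Admissible.τ_pos (hP : P.Admissible) (m : Mesh) : 0 < P.τ m :=
  div_pos hP.hT (by exact_mod_cast m.N_pos)

theorem τ_mul_N (m : Mesh) : m.N * P.τ m = P.T := by
  have : (m.N : ℝ) ≠ 0 := by exact_mod_cast m.N_pos.ne'
  rw [τ]
  field_simp

theorem Admissible.gx_mem (hP : P.Admissible) (m : Mesh) (i : Fin m.M₁) :
    P.gx m ((i : ℕ) + 1) ∈ Set.Ioo P.xL P.xR := by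
  have h := hP.h₁_pos m
  have hi : ((i : ℕ) : ℝ) + 1 ≤ m.M₁ := by exact_mod_cast i.2
  have hb : (m.M₁ + 1) * P.h₁ m = P.xR - P.xL := by rw [h₁]; field_simp
  rw [gx]
  push_cast
  constructor
  · have : 0 < (((i : ℕ) : ℝ) + 1) * P.h₁ m := by positivity
    linarith
  · nlinarith

theorem Admissible.gy_mem (hP : P.Admissible) (m : Mesh) (j : Fin m.M₂) :
    P.gy m ((j : ℕ) + 1) ∈ Set.Ioo P.yL P.yR := by
  have h := hP.h₂_pos m
  have hj : ((j : ℕ) : ℝ) + 1 ≤ m.M₂ := by exact_mod_cast j.2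
  have hb : (m.M₂ + 1) * P.h₂ m = P.yR - P.yL := by rw [h₂]; field_simp
  rw [gy]
  push_cast
  constructor
  · have : 0 < (((j : ℕ) : ℝ) + 1) * P.h₂ m := by positivity
    linarith
  · nlinarith

theorem mem_frontier_Ω {x y : ℝ} (hcl : (x, y) ∈ Set.Icc P.xL P.xR ×ˢ Set.Icc P.yL P.yR)
    (hx : P.xL < P.xR) (hy : P.yL < P.yR) (hn : (x, y) ∉ P.Ω) : (x, y) ∈ frontier P.Ω := by
  have ho : IsOpen P.Ω := isOpen_Ioo.prod isOpen_Ioo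
  rw [ho.frontier_eq]
  refine ⟨?_, hn⟩
  rw [Ω, closure_prod_eq, closure_Ioo hx.ne, closure_Ioo hy.ne]
  exact hcl

theorem IsSolution.eq_zero_right {u : ℝ → ℝ → ℝ → ℝ} (hP : P.Admissible) (hu : P.IsSolution u)
    {y t : ℝ} (hy : y ∈ Set.Ioo P.yL P.yR) (ht : t ∈ Set.Icc 0 P.T) : u P.xR y t = 0 :=
  hu.boundary _ _ (mem_frontier_Ω ⟨⟨hP.hx.le, le_rfl⟩, Set.Ioo_subset_Icc_self hy⟩ hP.hx hP.hy
    fun h => lt_irrefl _ h.1.2) t ht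

theorem IsSolution.eq_zero_top {u : ℝ → ℝ → ℝ → ℝ} (hP : P.Admissible) (hu : P.IsSolution u)
    {x t : ℝ} (hx : x ∈ Set.Ioo P.xL P.xR) (ht : t ∈ Set.Icc 0 P.T) : u x P.yR t = 0 :=
  hu.boundary _ _ (mem_frontier_Ω ⟨Set.Ioo_subset_Icc_self hx, ⟨hP.hy.le, le_rfl⟩⟩ hP.hx hP.hy
    fun h => lt_irrefl _ h.2.2) t ht

theorem A_mulVec_apply (m : Mesh) (v : m.Idx → ℝ) (p : m.Idx) :
    (P.A m *ᵥ v) p =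
      P.sample m P.d p / 2 *
        ((P.h₁ m ^ P.α)⁻¹ * (G P.α m.M₁ *ᵥ fun k => v (p.1, k)) p.2) +
      P.sample m P.e p / 2 *
        ((P.h₂ m ^ P.β)⁻¹ * (G P.β m.M₂ *ᵥ fun k => v (k, p.2)) p.1) := by
  obtain ⟨j, i⟩ := p
  have h1 : (((1 : Matrix (Fin m.M₂) (Fin m.M₂) ℝ) ⊗ₖ G P.α m.M₁) *ᵥ v) (j, i) =
      (G P.α m.M₁ *ᵥ fun k => v (j, k)) i := by
    simp [Matrix.mulVec, dotProduct, Fintype.sum_prod_type, Matrix.kroneckerMap_apply,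
      Matrix.one_apply]
  have h2 : ((G P.β m.M₂ ⊗ₖ (1 : Matrix (Fin m.M₁) (Fin m.M₁) ℝ)) *ᵥ v) (j, i) =
      (G P.β m.M₂ *ᵥ fun k => v (k, i)) j := by
    simp [Matrix.mulVec, dotProduct, Fintype.sum_prod_type, Matrix.kroneckerMap_apply,
      Matrix.one_apply]
  rw [A, Matrix.add_mulVec, Matrix.smul_mulVec, Matrix.smul_mulVec, ← Matrix.mulVec_mulVec,
    ← Matrix.mulVec_mulVec, Pi.add_apply, Pi.smul_apply, Pi.smul_apply, Matrix.mulVec_diagonal,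
    Matrix.mulVec_diagonal, h1, h2, smul_eq_mul, smul_eq_mul]
  rw [one_div, one_div, mul_inv, mul_inv]
  ring

/-- The local truncation error of the scheme. -/
def truncation (P : Problem) (m : Mesh) (u : ℝ → ℝ → ℝ → ℝ) (n : ℕ) : m.Idx → ℝ :=
  (1 / P.τ m) • (P.sample m (fun x y => u x y (P.gt m (n + 1))) -
      P.sample m fun x y => u x y (P.gt m n)) -
    (P.A m *ᵥ (P.sample m (fun x y => u x y (P.gt m n)) +
      P.sample m fun x y => u x y (P.gt m (n + 1))) +
    P.sample m fun x y => P.f x y ((P.gt m n + P.gt m (n + 1)) / 2))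

/-- Linearity: `truncation` is the residual of the sampled exact solution, and the source `f`
cancels. -/
theorem err_step (m : Mesh) {u : ℝ → ℝ → ℝ → ℝ} {U : Fin (m.N + 1) → m.Idx → ℝ}
    (hU : P.IsSchemeSolution m U) (n : Fin m.N) :
    (1 / P.τ m) • (P.err m u U n.succ - P.err m u U n.castSucc) =
      P.A m *ᵥ (P.err m u U n.castSucc + P.err m u U n.succ) + P.truncation m u n := by
  have he : ∀ k : Fin (m.N + 1), P.err m u U k =
      P.sample m (fun x y => u x y (P.gt m (k : ℕ))) - U k := fun k => rfl
  have h := hU.2 n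
  rw [truncation, he, he, Fin.val_succ, Fin.val_castSucc]
  rw [smul_sub, Matrix.mulVec_add] at h
  simp only [smul_sub, Matrix.mulVec_add, Matrix.mulVec_sub]
  linear_combination (exp := 1) -h

theorem exists_abs_truncation_le (hP : P.Admissible) {u : ℝ → ℝ → ℝ → ℝ} (hu : P.IsSolution u)
    (hsmooth : P.SmoothEnough u) :
    ∃ C, 0 ≤ C ∧ ∀ (m : Mesh) (n : ℕ), n < m.N → ∀ p : m.Idx,
      |P.truncation m u n p| ≤ C * (P.τ m ^ 2 + P.h₁ m ^ 2 + P.h₂ m ^ 2) := by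
  obtain ⟨K, hKx, hKy, hKt⟩ := hsmooth
  obtain ⟨Bd, hBd⟩ := hP.d_bdd
  obtain ⟨Be, hBe⟩ := hP.e_bdd
  obtain ⟨Cx, hCx0, hCx⟩ := exists_abs_G_mulVec_sub_rlDeriv_le hP.hα
  obtain ⟨Cy, hCy0, hCy⟩ := exists_abs_G_mulVec_sub_rlDeriv_le hP.hβ
  have hmid : ((P.xL + P.xR) / 2, (P.yL + P.yR) / 2) ∈ P.Ω := by
    have := hP.hx
    have := hP.hy
    constructor <;> constructor <;> simp only <;> linarith
  have hK0 : 0 ≤ K :=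
    (abs_nonneg _).trans ((hKt _ _ hmid).1.2 0 ⟨le_rfl, hP.hT.le⟩)
  have hBd0 : 0 ≤ Bd := (hP.d_nonneg _ _ hmid).trans (hBd _ _ hmid)
  have hBe0 : 0 ≤ Be := (hP.e_nonneg _ _ hmid).trans (hBe _ _ hmid)
  refine ⟨K + Bd * (Cx * K + K) + Be * (Cy * K + K), by positivity, fun m n hn p => ?_⟩
  obtain ⟨j, i⟩ := p
  have hτ := hP.τ_pos m
  have hx := hP.gx_mem m i
  have hy := hP.gy_mem m j
  have hΩ : (P.gx m ((i : ℕ) + 1), P.gy m ((j : ℕ) + 1)) ∈ P.Ω := ⟨hx, hy⟩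
  set x := P.gx m ((i : ℕ) + 1) with hxdef
  set y := P.gy m ((j : ℕ) + 1) with hydef
  set σ := P.τ m / 2 with hσ
  set t := (P.gt m n + P.gt m (n + 1)) / 2 with ht
  have hσ0 : 0 < σ := half_pos hτ
  have ht0 : P.gt m n = t - σ := by simp only [ht, hσ, gt]; push_cast; ring
  have ht1 : P.gt m (n + 1) = t + σ := by simp only [ht, hσ, gt]; push_cast; ring
  have hlo : 0 ≤ t - σ := by rw [← ht0, gt]; positivity
  have hhi : t + σ ≤ P.T := by
    rw [← ht1, gt, ← τ_mul_N m]
    have : ((n + 1 : ℕ) : ℝ) ≤ m.N := by exact_mod_cast hn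
    gcongr
  have hm0 : t - σ ∈ Set.Icc 0 P.T := ⟨hlo, by linarith⟩
  have hm1 : t + σ ∈ Set.Icc 0 P.T := ⟨by linarith, hhi⟩
  have hmt : t ∈ Set.Ioc 0 P.T := ⟨by linarith, by linarith⟩
  obtain ⟨⟨hu3, hu3K⟩, ⟨hx2, hx2K⟩, ⟨hy2, hy2K⟩⟩ := hKt x y hΩ
  set Dx : ℝ → ℝ := fun r => rlDeriv P.xL P.α (fun ξ => u ξ y r) x
  set Dy : ℝ → ℝ := fun r => rlDeriv P.yL P.β (fun η => u x η r) y
  have hpde := hu.pde x y hΩ t hmt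
  have e1 := abs_sub_sub_two_mul_le_of_contDiffOn hP.hT hu3 hu3K hσ0.le hlo hhi hpde
  have e2 : |Dx (t + σ) + Dx (t - σ) - 2 * Dx t| ≤ 2 * K * σ ^ 2 :=
    abs_add_sub_two_mul_le_of_contDiffOn hP.hT hx2 hx2K hσ0.le hlo hhi
  have e3 : |Dy (t + σ) + Dy (t - σ) - 2 * Dy t| ≤ 2 * K * σ ^ 2 :=
    abs_add_sub_two_mul_le_of_contDiffOn hP.hT hy2 hy2K hσ0.le hlo hhi
  set Sx : ℝ → ℝ := fun r => (P.h₁ m ^ P.α)⁻¹ *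
    (G P.α m.M₁ *ᵥ fun k => P.sample m (fun x y => u x y r) (j, k)) i
  set Sy : ℝ → ℝ := fun r => (P.h₂ m ^ P.β)⁻¹ *
    (G P.β m.M₂ *ᵥ fun k => P.sample m (fun x y => u x y r) (k, i)) j
  have hSx : ∀ r ∈ Set.Icc 0 P.T, |Sx r - Dx r| ≤ Cx * P.h₁ m ^ 2 * K := by
    intro r hr
    have h := hCx P.xL P.xR K (fun ξ => u ξ y r) hP.hx (hKx y hy r hr)
      (hu.eq_zero_right hP hy hr) m.M₁ (P.h₁ m) rfl i
    simp only [Sx, Dx, sample, hxdef, gx]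
    push_cast
    exact h
  have hSy : ∀ r ∈ Set.Icc 0 P.T, |Sy r - Dy r| ≤ Cy * P.h₂ m ^ 2 * K := by
    intro r hr
    have h := hCy P.yL P.yR K (fun η => u x η r) hP.hy (hKy x hx r hr)
      (hu.eq_zero_top hP hx hr) m.M₂ (P.h₂ m) rfl j
    simp only [Sy, Dy, sample, hydef, gy]
    push_cast
    exact h
  -- The equation at the midpoint `t` is inserted. What remains is the central difference error, the
  -- spatial errors at both time levels and the averaging errors of the fractional derivatives.
  have hR : P.truncation m u n (j, i) =
      (u x y (t + σ) - u x y (t - σ) - 2 * σ * (P.d x y * Dx t + P.e x y * Dy t + P.f x y t)) /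
        P.τ m -
      P.d x y / 2 * ((Sx (t - σ) - Dx (t - σ)) + (Sx (t + σ) - Dx (t + σ)) +
        (Dx (t + σ) + Dx (t - σ) - 2 * Dx t)) -
      P.e x y / 2 * ((Sy (t - σ) - Dy (t - σ)) + (Sy (t + σ) - Dy (t + σ)) +
        (Dy (t + σ) + Dy (t - σ) - 2 * Dy t)) := by
    have hτσ : P.τ m = 2 * σ := by rw [hσ]; ring
    rw [truncation, Matrix.mulVec_add, ht0, ht1]
    simp only [Pi.sub_apply, Pi.add_apply, Pi.smul_apply, smul_eq_mul, A_mulVec_apply]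
    have s1 : ∀ v : ℝ → ℝ → ℝ, P.sample m v (j, i) = v x y := fun v => rfl
    simp only [s1]
    have s2 : (t - σ + (t + σ)) / 2 = t := by ring
    rw [s2, hτσ]
    simp only [Sx, Sy]
    field_simp
    ring
  have hd0 := hP.d_nonneg x y hΩ
  have he0 := hP.e_nonneg x y hΩ
  have b1 : |(u x y (t + σ) - u x y (t - σ) - 2 * σ *
      (P.d x y * Dx t + P.e x y * Dy t + P.f x y t)) / P.τ m| ≤ K * P.τ m ^ 2 := by
    rw [abs_div, abs_of_pos hτ, div_le_iff₀ hτ]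
    refine e1.trans ?_
    rw [hσ]
    have : 0 ≤ K * P.τ m ^ 3 := by positivity
    nlinarith
  have hcoef : ∀ {c B C h S₀ S₁ D : ℝ}, 0 ≤ c → c ≤ B → 0 ≤ C → |S₀| ≤ C * h ^ 2 * K →
      |S₁| ≤ C * h ^ 2 * K → |D| ≤ 2 * K * σ ^ 2 →
      |c / 2 * (S₀ + S₁ + D)| ≤ B * (C * K * h ^ 2 + K * P.τ m ^ 2) := by
    intro c B C h S₀ S₁ D hc hcB hC h0 h1 hD
    rw [abs_mul, abs_of_nonneg (by positivity : 0 ≤ c / 2)]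
    have h2 : |S₀ + S₁ + D| ≤ 2 * (C * K * h ^ 2 + K * P.τ m ^ 2) := by
      refine (abs_add_three _ _ _).trans ?_
      have h3 : K * σ ^ 2 ≤ K * P.τ m ^ 2 := by
        gcongr
        rw [hσ]
        linarith
      linarith
    calc _ ≤ c / 2 * (2 * (C * K * h ^ 2 + K * P.τ m ^ 2)) := by gcongr
      _ = c * (C * K * h ^ 2 + K * P.τ m ^ 2) := by ring
      _ ≤ _ := by gcongr
  have b2 := hcoef hd0 (hBd x y hΩ) hCx0 (hSx _ hm0) (hSx _ hm1) e2
  have b3 := hcoef he0 (hBe x y hΩ) hCy0 (hSy _ hm0) (hSy _ hm1) e3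
  rw [hR]
  refine (abs_sub _ _).trans ((add_le_add ((abs_sub _ _).trans (add_le_add b1 b2)) b3).trans ?_)
  have p1 : 0 ≤ K * (P.h₁ m ^ 2 + P.h₂ m ^ 2) := by positivity
  have p2 : 0 ≤ Bd * (Cx * K) * (P.τ m ^ 2 + P.h₂ m ^ 2) := by positivity
  have p3 : 0 ≤ Bd * K * (P.h₁ m ^ 2 + P.h₂ m ^ 2) := by positivity
  have p4 : 0 ≤ Be * (Cy * K) * (P.τ m ^ 2 + P.h₁ m ^ 2) := by positivity
  have p5 : 0 ≤ Be * K * (P.h₁ m ^ 2 + P.h₂ m ^ 2) := by positivity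
  linarith

theorem gridNorm_eq (hP : P.Admissible) (m : Mesh) (v : m.Idx → ℝ) :
    P.gridNorm m v = √(P.h₁ m * P.h₂ m) * ‖WithLp.toLp 2 v‖ := by
  rw [gridNorm, Real.sqrt_mul (mul_pos (hP.h₁_pos m) (hP.h₂_pos m)).le, ← norm_toLp_sq,
    Real.sqrt_sq (norm_nonneg _)]

theorem norm_toLp_le_of_abs_le {ι : Type*} [Fintype ι] {v : ι → ℝ} {ρ : ℝ} (hρ : 0 ≤ ρ)
    (hv : ∀ i, |v i| ≤ ρ) : ‖WithLp.toLp 2 v‖ ≤ √(Fintype.card ι) * ρ := by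
  refine le_of_sq_le_sq ?_ (by positivity)
  rw [norm_toLp_sq, mul_pow, Real.sq_sqrt (by positivity), dotProduct]
  calc ∑ i, v i * v i ≤ ∑ _i : ι, ρ ^ 2 := Finset.sum_le_sum fun i _ => by
        rw [← abs_mul_abs_self, ← pow_two]
        have := hv i
        gcongr
    _ = _ := by simp

/-- The cells attached to the interior points fit into the rectangle, so a pointwise bound gives a
grid norm bound independent of the mesh. -/
theorem h₁_mul_h₂_mul_card_le (hP : P.Admissible) (m : Mesh) :
    P.h₁ m * P.h₂ m * Fintype.card m.Idx ≤ (P.xR - P.xL) * (P.yR - P.yL) := by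
  have h1 : P.h₁ m * m.M₁ ≤ P.xR - P.xL := by
    have hb : P.h₁ m * (m.M₁ + 1) = P.xR - P.xL := by rw [h₁]; field_simp
    linarith [hP.h₁_pos m]
  have h2 : P.h₂ m * m.M₂ ≤ P.yR - P.yL := by
    have hb : P.h₂ m * (m.M₂ + 1) = P.yR - P.yL := by rw [h₂]; field_simp
    linarith [hP.h₂_pos m]
  have h3 := hP.h₂_pos m
  rw [Fintype.card_prod, Fintype.card_fin, Fintype.card_fin]
  push_cast
  calc _ = (P.h₁ m * m.M₁) * (P.h₂ m * m.M₂) := by ring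
    _ ≤ _ := mul_le_mul h1 h2 (by positivity) (sub_nonneg.2 hP.hx.le)

end Problem

end OSFDE

end

/-! ### Convergence -/

theorem theorem3p2 (P : OSFDE.Problem) (hP : P.Admissible)
    (u : ℝ → ℝ → ℝ → ℝ) (hu : P.IsSolution u) (hsmooth : P.SmoothEnough u)
    (Q : (m : OSFDE.Mesh) → Matrix m.Idx m.Idx ℝ) (hQ : Q ∈ P.𝔇) :
    ∃ c₄ : ℝ, 0 < c₄ ∧ ∀ m : OSFDE.Mesh,
      (∃! U : Fin (m.N + 1) → m.Idx → ℝ, P.IsSchemeSolution m U) ∧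
      ∀ U : Fin (m.N + 1) → m.Idx → ℝ, P.IsSchemeSolution m U →
        ∀ n : Fin (m.N + 1),
          P.gridNorm m (P.err m u U n) ≤ c₄ * (P.τ m ^ 2 + P.h₁ m ^ 2 + P.h₂ m ^ 2) := by
  obtain ⟨hQm, c, hc⟩ := hQ
  obtain ⟨C, hC0, hC⟩ := OSFDE.Problem.exists_abs_truncation_le hP hu hsmooth
  set L := (P.xR - P.xL) * (P.yR - P.yL)
  have hT := hP.hT
  -- The factors come from the area, the condition number, `n τ ≤ T` and the truncation bound; the
  -- `1` only ensures positivity.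
  refine ⟨√L * √c * P.T * C + 1, by positivity, fun m => ⟨?_, fun U hU n => ?_⟩⟩
  · exact OSFDE.existsUnique_crankNicolson (hQm m).1 (hQm m).2 (hP.τ_pos m) m.N
      (P.sample m P.φ) fun n => P.sample m fun x y => P.f x y ((P.gt m n + P.gt m (n + 1)) / 2)
  · have hτ := hP.τ_pos m
    set S := P.τ m ^ 2 + P.h₁ m ^ 2 + P.h₂ m ^ 2
    have hS : 0 ≤ S := by positivity
    have h0 : P.err m u U 0 = 0 := by
      funext p
      have hx := hP.gx_mem m p.2
      have hy := hP.gy_mem m p.1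
      have h1 : P.err m u U 0 p = u (P.gx m ((p.2 : ℕ) + 1)) (P.gy m ((p.1 : ℕ) + 1))
          (P.gt m 0) - U 0 p := rfl
      have h2 : P.gt m 0 = 0 := by simp [OSFDE.Problem.gt]
      have h3 := hu.initial _ _ (subset_closure (show
        (P.gx m ((p.2 : ℕ) + 1), P.gy m ((p.1 : ℕ) + 1)) ∈ P.Ω from ⟨hx, hy⟩))
      rw [h1, hU.1, h2, h3]
      exact sub_self _
    have h1 := OSFDE.norm_le_of_crankNicolson (hQm m).1 (hQm m).2 (hc m) hτ h0
      (OSFDE.Problem.err_step m hU)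
      (fun k => OSFDE.Problem.norm_toLp_le_of_abs_le (mul_nonneg hC0 hS) (hC m k k.2))
      (by positivity) n
    have hn : ((n : ℕ) : ℝ) * P.τ m ≤ P.T := by
      rw [← OSFDE.Problem.τ_mul_N m]
      have : ((n : ℕ) : ℝ) ≤ m.N := by exact_mod_cast Nat.lt_succ_iff.1 n.2
      gcongr
    have hcard : √(P.h₁ m * P.h₂ m) * √(Fintype.card m.Idx) ≤ √L := by
      rw [← Real.sqrt_mul (mul_pos (hP.h₁_pos m) (hP.h₂_pos m)).le]
      exact Real.sqrt_le_sqrt (OSFDE.Problem.h₁_mul_h₂_mul_card_le hP m)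
    rw [OSFDE.Problem.gridNorm_eq hP]
    calc _ ≤ √(P.h₁ m * P.h₂ m) * (√c * (P.T * (√(Fintype.card m.Idx) * (C * S)))) := by
          refine mul_le_mul_of_nonneg_left (h1.trans ?_) (Real.sqrt_nonneg _)
          gcongr
      _ = (√(P.h₁ m * P.h₂ m) * √(Fintype.card m.Idx)) * (√c * P.T * (C * S)) := by ring
      _ ≤ √L * (√c * P.T * (C * S)) := by gcongr
      _ ≤ _ := by linarith
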